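/- A \emph{parking function} of length $n$ is a vector $(p_1,\dots,p_n)$ of integers with $1\le p_i\le n$ whose weakly increasing rearrangement $p_{(1)}\le\dots\le p_{(n)}$ satisfies $p_{(i)}\le i$ for $1\le i\le n$. Its \emph{area} is $\frac{n(n+1)}{2}-(p_1+\dots+p_n)$. Let $X_n$ be the area of a uniformly random parking function of length $n$, let $E_1(n)=\mathbb{E}[X_n]$, and let $E_k(n)=\mathbb{E}[X_n(X_n-1)\cdots(X_n-k+1)]$ be its $k$-th factorial moment. Then for every $n\ge 0$ $$E_1(n)=-\frac n2+\frac12\,\frac{(n+1)!}{(n+1)^n}\sum_{k=0}^{n-1}\frac{(n+1)^k}{k!},$$ and for $2\le k\le 6$ and every $n\ge 0$ one has $E_k(n)=A_k(n)+B_k(n)\,E_1(n)$, where $$A_2=\tfrac{5}{12}n^3-\tfrac1{12}n^2-\tfrac13 n,\qquad B_2=-\tfrac73(n+1);$$ $$A_3=-\tfrac{175}{192}n^4-\tfrac{283}{192}n^3+\tfrac{199}{192}n^2+\tfrac{259}{192}n,\qquad B_3=\tfrac{15}{32}n^3+\tfrac{521}{96}n^2+\tfrac{1219}{96}n+\tfrac{743}{96};$$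 $$A_4=\tfrac{221}{1008}n^6+\tfrac{63737}{30240}n^5+\tfrac{101897}{15120}n^4+\tfrac{22217}{5040}n^3-\tfrac{1375}{189}n^2-\tfrac{187463}{30240}n,$$ $$B_4=-\tfrac{35}{16}n^4-\tfrac{449}{27}n^3-\tfrac{130243}{2520}n^2-\tfrac{7409}{105}n-\tfrac{503803}{15120};$$ $$A_5=-\tfrac{105845}{110592}n^7-\tfrac{2170159}{290304}n^6-\tfrac{99955651}{3870720}n^5-\tfrac{30773609}{725760}n^4-\tfrac{94846903}{11612160}n^3+\tfrac{24676991}{483840}n^2+\tfrac{392763901}{11612160}n,$$ $$B_5=\tfrac{565}{2048}n^6+\tfrac{1005}{128}n^5+\tfrac{9832585}{165888}n^4+\tfrac{1111349}{5184}n^3+\tfrac{826358527}{1935360}n^2+\tfrac{159943787}{362880}n+\tfrac{1024580441}{5806080};$$ $$A_6=\tfrac{82825}{576576}n^9+\tfrac{373340075}{110702592}n^8+\tfrac{9401544029}{332107776}n^7+\tfrac{14473244813}{127733760}n^6+\tfrac{414139396709}{1660538880}n^5+\tfrac{88215445651}{332107776}n^4-\tfrac{18783816473}{332107776}n^3-\tfrac{643359542029}{1660538880}n^2-\tfrac{358936540409}{1660538880}n,$$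 $$B_6=-\tfrac{3955}{2048}n^7-\tfrac{186349}{6144}n^6-\tfrac{259283273}{1161216}n^5-\tfrac{119912501}{129024}n^4-\tfrac{149860633081}{63866880}n^3-\tfrac{601794266581}{166053888}n^2-\tfrac{864000570107}{276756480}n-\tfrac{921390308389}{830269440}.$$ Moreover, as $n\to\infty$, $$E_2(n)=\tfrac5{12}n^3+O(n^{5/2}),\qquad E_3(n)=\tfrac{15}{128}\sqrt{2\pi}\,n^{9/2}+O(n^4),\qquad E_4(n)=\tfrac{221}{1008}n^6+O(n^{11/2}),$$ $$E_5(n)=\tfrac{565}{8192}\sqrt{2\pi}\,n^{15/2}+O(n^7),\qquad E_6(n)=\tfrac{82825}{576576}n^9+O(n^{17/2}).$$ These leading terms are those of the Airy distribution (the law of the area under a normalized Brownian excursion): if $$e_k=\frac{4\sqrt\pi\,2^{-k/2}\,k!}{\Gamma\left(\frac{3k-1}{2}\right)}K_k,\qquad K_0=-\tfrac12,\qquad K_k=\tfrac{3k-4}{4}K_{k-1}+\sum_{j=1}^{k-1}K_jK_{k-j}\quad(k\ge1),$$ is the sequence of its moments, as given by their standard recurrence, then $E_k(n)=e_k\,n^{3k/2}+O\left(n^{(3k-1)/2}\right)$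 as $n\to\infty$ for $1\le k\le 6$. -/

import Mathlib

open Filter Asymptotics

noncomputable section

namespace Parking

/-- The weakly increasing rearrangement `p₍₁₎ ≤ ⋯ ≤ p₍ₙ₎` of a vector `p` of length `n`
(entries are indexed by `Fin n`, that is, from `0`). -/
def sorted {n : ℕ} (p : Fin n → ℕ) : Fin n → ℕ := p ∘ Tuple.sort p

/-- `p` is a parking function of length `n`: its entries lie in `{1, …, n}` and its sorted version
satisfies `p₍ᵢ₎ ≤ i` for `1 ≤ i ≤ n`. -/
def IsParkingFunction {n : ℕ} (p : Fin n → ℕ) : Prop :=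
  (∀ i, 1 ≤ p i ∧ p i ≤ n) ∧ ∀ i : Fin n, sorted p i ≤ (i : ℕ) + 1

open Classical in
/-- The finite set of all parking functions of length `n`. -/
def parkingFunctions (n : ℕ) : Finset (Fin n → ℕ) :=
  (Fintype.piFinset fun _ : Fin n => Finset.Icc 1 n).filter IsParkingFunction

theorem mem_parkingFunctions {n : ℕ} (p : Fin n → ℕ) :
    p ∈ parkingFunctions n ↔ IsParkingFunction p := by
  simp only [parkingFunctions, Finset.mem_filter, Fintype.mem_piFinset, Finset.mem_Icc]
  exact ⟨fun h => h.2, fun h => ⟨h.1, h⟩⟩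

/-- The area statistic `n (n + 1) / 2 - (p₁ + ⋯ + pₙ)`. -/
def area {n : ℕ} (p : Fin n → ℕ) : ℝ := (n : ℝ) * (n + 1) / 2 - ∑ i, (p i : ℝ)

/-- The expectation of `f` for a uniformly random parking function of length `n`. -/
def expectation (n : ℕ) (f : (Fin n → ℕ) → ℝ) : ℝ :=
  (∑ p ∈ parkingFunctions n, f p) / ((parkingFunctions n).card : ℝ)

/-- `E₁(n)`, the expectation of the area statistic on parking functions of length `n`. -/
def E₁ (n : ℕ) : ℝ := expectation n area

/-- The `k`-th factorial moment `E[X (X - 1) ⋯ (X - k + 1)]` of the area `X` of parking functions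
of length `n`. -/
def factorialMoment (k n : ℕ) : ℝ :=
  expectation n fun p => ∏ j ∈ Finset.range k, (area p - (j : ℝ))

/-- The constants `K₀ = -1/2`, `K_k = (3k - 4)/4 * K_{k-1} + ∑_{j=1}^{k-1} K_j K_{k-j}`. -/
def airyK : ℕ → ℝ
  | 0 => -1 / 2
  | k + 1 => (3 * ((k : ℝ) + 1) - 4) / 4 * airyK k
      + ∑ j : Fin k, airyK ((j : ℕ) + 1) * airyK (k - (j : ℕ))

/-- The `k`-th moment of the Airy distribution (the law of the area under a normalized Brownian
excursion): `e_k = 4 √π 2^{-k/2} k! / Γ((3k - 1)/2) * K_k`. -/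
def airyMoment (k : ℕ) : ℝ :=
  4 * √Real.pi * (2 : ℝ) ^ (-(k : ℝ) / 2) * (k.factorial : ℝ)
    / Real.Gamma ((3 * (k : ℝ) - 1) / 2) * airyK k

end Parking

end

/-! Split preference vectors by the first spot that stays empty: the cars before it form a parking
function, the remaining cars prefer spots beyond it. With arbitrary spot weights this gives
`sum_pow_eq_sum_parkSum`, which is used twice.

With weights whose tail sums are powers of `1 + X`, it says that the generating function
`areaSeries` of the area enumerators (in the variable `X = q - 1`) is the logarithmic derivative of
the generating function of all graphs. The latter satisfies a heat equation, so `areaSeries`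
satisfies a Riccati-type equation (`coeffDeriv_areaSeries`). Its coefficients in `X` are the
factorial moments up to normalization, and each `momentSeries (k + 1)` is determined by the earlier
ones.

With unit weights, it gives Abel's identities, hence the count `(n + 1) ^ (n - 1)` and the calculus
of the tree function `T`. Write `M` for `momentSeries 0` and `t = T / (1 - T)` for `treeVar`. The
Euler operator sends `M` to `M * t` and `t` to `t * (1 + t) ^ 2`, so it acts on the products `M *
p(t)` through `treeEuler`. For `k ≤ 6` the moment series are such products, with the polynomials
`areaTree k`.

On coefficients, `treeEuler` is multiplication by `n`. Its iterates on `1` have degrees 0, 1, 3, 5,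
..., and those on `X ^ 2` have degrees 2, 4, 6, ...; together they form a basis of the polynomials.
The coefficients of `M` and `M * t ^ 2` are those of the zeroth moment and twice the first, so
expanding `areaTree k` in this basis yields `A_k + B_k * E₁`. Since `areaTree k` has degree `3 * k -
1` for `1 ≤ k ≤ 6`, the parity of `k` decides whether `A_k` or `B_k * E₁` dominates.

For the asymptotics, `E₁` is an affine expression in Ramanujan's function `Q(n + 1)`, and
`ramanujanQ_le` and `le_ramanujanQ` give `Q(N) = √(πN/2) + O(1)`. The Airy moments for `k ≤ 6` are
then computed and compared with the leading constants. -/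

namespace Parking

/-! ### Parking preferences on an arbitrary finite set of cars -/

/-- A function on a finite type of cars is a parking preference if its values are positive and at
least `j` cars prefer one of the first `j` spots, for every `j` up to the number of cars. -/
def IsPark {ι : Type*} [Fintype ι] (p : ι → ℕ) : Prop :=
  (∀ i, 1 ≤ p i) ∧ ∀ j ≤ Fintype.card ι, j ≤ (Finset.univ.filter fun i => p i ≤ j).card

theorem IsPark.le_card {ι : Type*} [Fintype ι] {p : ι → ℕ} (h : IsPark p) (i : ι) :
    p i ≤ Fintype.card ι := by
  have h1 := h.2 _ le_rfl
  have h2 : (Finset.univ.filter fun i => p i ≤ Fintype.card ι) = Finset.univ :=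
    Finset.eq_univ_of_card _ (le_antisymm (Finset.card_le_univ _) h1)
  have h3 := Finset.mem_univ i
  rw [← h2] at h3
  exact (Finset.mem_filter.1 h3).2

theorem card_sorted_le {n : ℕ} (p : Fin n → ℕ) (j : ℕ) :
    (Finset.univ.filter fun i => sorted p i ≤ j).card =
      (Finset.univ.filter fun i => p i ≤ j).card := by
  exact Finset.card_equiv (Tuple.sort p) fun i => by
    rw [Finset.mem_filter, Finset.mem_filter]; simp [sorted]

/-- A sorted vector has its `i`-th entry at most `a` exactly when more than `i` entries (counting
from 0) are at most `a`. The counting form ignores the order of the cars, so it makes sense on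
subsets of the cars. -/
theorem isParkingFunction_iff {n : ℕ} (p : Fin n → ℕ) : IsParkingFunction p ↔ IsPark p := by
  have key : ∀ (i : Fin n) (a : ℕ), (i : ℕ) < (Finset.univ.filter fun i => p i ≤ a).card ↔
      sorted p i ≤ a := fun i a => by
    rw [← card_sorted_le]
    exact Tuple.lt_card_le_iff_apply_le_of_monotone (Tuple.monotone_sort p)
  constructor
  · rintro ⟨h1, h2⟩
    refine ⟨fun i => (h1 i).1, fun j hj => ?_⟩
    rw [Fintype.card_fin] at hj
    rcases j with _ | j
    · exact Nat.zero_le _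
    · exact (key ⟨j, hj⟩ (j + 1)).2 (h2 ⟨j, hj⟩)
  · intro h
    refine ⟨fun i => ⟨h.1 i, by simpa using h.le_card i⟩, fun i => ?_⟩
    exact (key i _).1 (h.2 (i + 1) (by simp))

open Classical in
/-- The finite set of parking preferences of a finite type of cars. -/
noncomputable def parkSet (ι : Type*) [Fintype ι] : Finset (ι → ℕ) :=
  (Fintype.piFinset fun _ : ι => Finset.Icc 1 (Fintype.card ι)).filter IsPark

theorem mem_parkSet {ι : Type*} [Fintype ι] {p : ι → ℕ} : p ∈ parkSet ι ↔ IsPark p := by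
  simp only [parkSet, Finset.mem_filter, Fintype.mem_piFinset, Finset.mem_Icc]
  exact ⟨fun h => h.2, fun h => ⟨fun i => ⟨h.1 i, h.le_card i⟩, h⟩⟩

theorem parkSet_fin (n : ℕ) : parkSet (Fin n) = parkingFunctions n := by
  ext p; rw [mem_parkSet, mem_parkingFunctions, isParkingFunction_iff]

theorem isPark_comp_equiv {ι κ : Type*} [Fintype ι] [Fintype κ] (e : ι ≃ κ) (p : κ → ℕ) :
    IsPark (p ∘ e) ↔ IsPark p := by
  have h : ∀ j, (Finset.univ.filter fun i => (p ∘ e) i ≤ j).card =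
      (Finset.univ.filter fun i => p i ≤ j).card := fun j => by
    refine Finset.card_bij' (fun i _ => e i) (fun i _ => e.symm i) ?_ ?_ ?_ ?_ <;> simp
  simp only [IsPark, h, Fintype.card_congr e]
  refine and_congr_left fun _ => ⟨fun h i => by simpa using h (e.symm i), fun h i => h _⟩

/-- The generating function of parking functions of length `n`, where spot `j` has weight `x j`. -/
noncomputable def parkSum {R : Type*} [CommRing R] (x : ℕ → R) (n : ℕ) : R :=
  ∑ p ∈ parkingFunctions n, ∏ i, x (p i)

theorem sum_parkSet {R : Type*} [CommRing R] (x : ℕ → R) (ι : Type*) [Fintype ι] :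
    ∑ p ∈ parkSet ι, ∏ i, x (p i) = parkSum x (Fintype.card ι) := by
  have e := Fintype.equivFin ι
  rw [parkSum, ← parkSet_fin]
  refine Finset.sum_bij' (fun p _ => p ∘ e.symm) (fun p _ => p ∘ e) ?_ ?_ ?_ ?_ ?_
  · intro p hp
    rw [mem_parkSet] at *
    rwa [isPark_comp_equiv]
  · intro p hp
    rw [mem_parkSet] at *
    rwa [isPark_comp_equiv]
  · intro p _; ext i; simp
  · intro p _; ext i; simp
  · intro p _
    exact (Equiv.prod_comp e.symm fun i => x (p i)).symm

/-! ### Decomposition by the first empty spot -/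

theorem exists_card_le {ι : Type*} [Fintype ι] (p : ι → ℕ) :
    ∃ j, (Finset.univ.filter fun i => p i ≤ j + 1).card ≤ j :=
  ⟨Fintype.card ι, Finset.card_le_univ _⟩

open Classical in
/-- The first spot that stays empty when cars with preferences `p` park is
`firstEmpty p + 1`. -/
noncomputable def firstEmpty {ι : Type*} [Fintype ι] (p : ι → ℕ) : ℕ := Nat.find (exists_card_le p)

/-- The cars parked before the first empty spot. -/
noncomputable def prefixCars {ι : Type*} [Fintype ι] (p : ι → ℕ) : Finset ι :=
  Finset.univ.filter fun i => p i ≤ firstEmpty p + 1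

/-- At most `firstEmpty p` cars prefer the first `firstEmpty p + 1` spots, and by minimality at
least `firstEmpty p` cars prefer the first `firstEmpty p` spots. Hence no car prefers spot
`firstEmpty p + 1`. -/
theorem card_prefixCars {ι : Type*} [Fintype ι] (p : ι → ℕ) :
    (prefixCars p).card = firstEmpty p := by
  classical
  refine le_antisymm (Nat.find_spec (exists_card_le p)) ?_
  rcases h : firstEmpty p with _ | j
  · exact Nat.zero_le _
  · have := Nat.find_min (exists_card_le p) (m := j) (by change j < firstEmpty p; omega)
    refine (Nat.succ_le_of_lt (not_le.1 this)).trans (Finset.card_le_card fun i hi => ?_)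
    simp only [prefixCars, Finset.mem_filter, Finset.mem_univ, true_and] at hi ⊢
    omega

theorem prefixCars_eq_iff {ι : Type*} [Fintype ι] (p : ι → ℕ) (hp : ∀ i, 1 ≤ p i) (S : Finset ι) :
    prefixCars p = S ↔ IsPark (fun i : {i // i ∈ S} => p i) ∧ ∀ i ∉ S, S.card + 2 ≤ p i := by
  classical
  have hcard : ∀ j, (Finset.univ.filter fun i : {i // i ∈ S} => p i ≤ j).card =
      (S.filter fun i => p i ≤ j).card := fun j => by
    rw [← Finset.card_map (Function.Embedding.subtype _)]
    congr 1
    ext i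
    simp [and_comm]
  constructor
  · rintro rfl
    refine ⟨⟨fun i => hp i, fun j hj => ?_⟩, fun i hi => ?_⟩
    · rw [Fintype.card_coe, card_prefixCars] at hj
      rw [hcard]
      rcases j with _ | j
      · exact Nat.zero_le _
      · have := Nat.find_min (exists_card_le p) (m := j) (by change j < firstEmpty p; omega)
        refine (Nat.succ_le_of_lt (not_le.1 this)).trans (Finset.card_le_card fun i hi => ?_)
        simp only [prefixCars, Finset.mem_filter, Finset.mem_univ, true_and] at hi ⊢
        omega
    · rw [card_prefixCars]
      simp only [prefixCars, Finset.mem_filter, Finset.mem_univ, true_and] at hi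
      omega
  · rintro ⟨h1, h2⟩
    have h3 : ∀ i ∈ S, p i ≤ S.card := fun i hi => by simpa using h1.le_card ⟨i, hi⟩
    have h4 : (Finset.univ.filter fun i => p i ≤ S.card + 1) = S := by
      ext i
      simp only [Finset.mem_filter, Finset.mem_univ, true_and]
      refine ⟨fun h => ?_, fun h => (h3 i h).trans (Nat.le_succ _)⟩
      by_contra hi
      have := h2 i hi
      omega
    have h5 : firstEmpty p = S.card := by
      refine (Nat.find_eq_iff _).2 ⟨by rw [h4], fun j hj => ?_⟩
      have := h1.2 (j + 1) (by simpa using hj)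
      rw [hcard] at this
      have h6 := this.trans (Finset.card_le_card (Finset.filter_subset_filter _ S.subset_univ))
      omega
    rw [prefixCars, h5, h4]

/-- By `prefixCars_eq_iff` the fibre over `S` is a product: a parking preference on `S`, and free
choices among the spots from `S.card + 2` to `m` for each car outside `S`. -/
theorem sum_prefixCars_eq {R : Type*} [CommRing R] (x : ℕ → R) {ι : Type*} [Fintype ι]
    [DecidableEq ι] {m : ℕ} (hm : Fintype.card ι < m) (S : Finset ι) :
    ∑ p ∈ (Fintype.piFinset fun _ : ι => Finset.Icc 1 m) with prefixCars p = S, ∏ i, x (p i) =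
      parkSum x S.card * (∑ j ∈ Finset.Icc (S.card + 2) m, x j) ^ (Fintype.card ι - S.card) := by
  have hS := S.card_le_univ
  have e1 : (∑ j ∈ Finset.Icc (S.card + 2) m, x j) ^ (Fintype.card ι - S.card) =
      ∑ q ∈ (Fintype.piFinset fun _ : {i // i ∉ S} => Finset.Icc (S.card + 2) m),
        ∏ i, x (q i) := by
    rw [Finset.sum_prod_piFinset _ fun _ j => x j, Finset.prod_const, Finset.card_univ,
      Fintype.card_subtype_compl, Fintype.card_coe]
  have e2 : parkSum x S.card = ∑ q ∈ parkSet {i // i ∈ S}, ∏ i, x (q i) := by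
    rw [sum_parkSet, Fintype.card_coe]
  rw [e1, e2, Finset.sum_mul_sum, ← Finset.sum_product']
  refine Finset.sum_equiv (Equiv.piEquivPiSubtypeProd (· ∈ S) fun _ => ℕ) (fun p => ?_) fun p _ => ?_
  · simp only [Finset.mem_filter, Fintype.mem_piFinset, Finset.mem_Icc, Finset.mem_product,
      mem_parkSet, Equiv.piEquivPiSubtypeProd_apply, Subtype.forall]
    constructor
    · rintro ⟨h1, h2⟩
      rw [prefixCars_eq_iff _ fun i => (h1 i).1] at h2
      exact ⟨h2.1, fun i hi => ⟨h2.2 i hi, (h1 i).2⟩⟩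
    · rintro ⟨h1, h2⟩
      have h3 : ∀ i, 1 ≤ p i ∧ p i ≤ m := fun i => by
        by_cases hi : i ∈ S
        · have ha := h1.1 ⟨i, hi⟩
          have hb := h1.le_card ⟨i, hi⟩
          simp only [Fintype.card_coe] at ha hb
          omega
        · have := h2 i hi
          omega
      refine ⟨h3, ?_⟩
      rw [prefixCars_eq_iff _ fun i => (h3 i).1]
      exact ⟨h1, fun i hi => (h2 i hi).1⟩
  · simp only [Equiv.piEquivPiSubtypeProd_apply]
    rw [← Fintype.prod_subtype_mul_prod_subtype (· ∈ S) fun i => x (p i)]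
    congr!

/-- Sorting all functions by the first empty spot. -/
theorem sum_pow_eq_sum_parkSum {R : Type*} [CommRing R] (x : ℕ → R) {n m : ℕ} (hm : n < m) :
    (∑ j ∈ Finset.Icc 1 m, x j) ^ n = ∑ i ∈ Finset.range (n + 1),
      (n.choose i : R) * (parkSum x i * (∑ j ∈ Finset.Icc (i + 2) m, x j) ^ (n - i)) := by
  have e1 : (∑ j ∈ Finset.Icc 1 m, x j) ^ n =
      ∑ p ∈ (Fintype.piFinset fun _ : Fin n => Finset.Icc 1 m), ∏ i, x (p i) := by
    rw [Finset.sum_prod_piFinset _ fun _ j => x j, Finset.prod_const, Finset.card_univ,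
      Fintype.card_fin]
  have e2 := Finset.sum_powerset_apply_card (fun i => parkSum x i *
    (∑ j ∈ Finset.Icc (i + 2) m, x j) ^ (n - i)) (x := (Finset.univ : Finset (Fin n)))
  simp only [Finset.card_univ, Fintype.card_fin, nsmul_eq_mul] at e2
  rw [e1, ← e2, ← Finset.sum_fiberwise_of_maps_to (g := prefixCars) (t := Finset.univ.powerset)
    fun p _ => by simp]
  refine Finset.sum_congr rfl fun S _ => ?_
  have := sum_prefixCars_eq x (ι := Fin n) (m := m) (by simpa using hm) S
  rwa [Fintype.card_fin] at this

/-! ### The area enumerator and its expansion at `q = 1` -/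

theorem sum_sorted {n : ℕ} (p : Fin n → ℕ) : ∑ i, sorted p i = ∑ i, p i :=
  Equiv.sum_comp (Tuple.sort p) p

theorem choose_two_identity (k : ℕ) : k.choose 2 * 2 + k = k * k := by
  induction k with
  | zero => rfl
  | succ k ih =>
    rw [Nat.choose_succ_succ' k 1, Nat.choose_one_right]
    nlinarith

theorem sum_le_choose {n : ℕ} {p : Fin n → ℕ} (hp : p ∈ parkingFunctions n) :
    ∑ i, p i ≤ (n + 1).choose 2 := by
  rw [mem_parkingFunctions] at hp
  rw [← sum_sorted, Nat.choose_two_right, ← Finset.sum_range_id, Finset.sum_range_succ',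
    Finset.sum_range fun i => i + 1]
  exact (Finset.sum_le_sum fun i _ => hp.2 i)

/-- The area as a natural number. -/
def natArea {n : ℕ} (p : Fin n → ℕ) : ℕ := (n + 1).choose 2 - ∑ i, p i

theorem sum_add_natArea {n : ℕ} {p : Fin n → ℕ} (hp : p ∈ parkingFunctions n) :
    ∑ i, p i + natArea p = (n + 1).choose 2 := Nat.add_sub_cancel' (sum_le_choose hp)

theorem area_eq_natArea {n : ℕ} {p : Fin n → ℕ} (hp : p ∈ parkingFunctions n) :
    area p = natArea p := by
  have h1 : ((∑ i, p i + natArea p : ℕ) : ℝ) = ((n + 1).choose 2 : ℕ) := by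
    rw [sum_add_natArea hp]
  have h2 : (((n + 1).choose 2 * 2 + (n + 1) : ℕ) : ℝ) = ((n + 1) * (n + 1) : ℕ) := by
    rw [choose_two_identity]
  push_cast at h1 h2
  rw [area]
  linarith

open Polynomial in
/-- The area enumerator of parking functions of length `n`, as a polynomial in `q - 1`. -/
noncomputable def areaPoly (n : ℕ) : ℝ[X] :=
  ∑ p ∈ parkingFunctions n, (1 + X) ^ natArea p

theorem coeff_areaPoly (n k : ℕ) :
    (areaPoly n).coeff k = ∑ p ∈ parkingFunctions n, ((natArea p).choose k : ℝ) := by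
  simp only [areaPoly, Polynomial.finsetSum_coeff, Polynomial.coeff_one_add_X_pow]

theorem prod_sub_eq_choose (a k : ℕ) :
    ∏ j ∈ Finset.range k, ((a : ℝ) - (j : ℝ)) = k.factorial * (a.choose k : ℝ) := by
  rw [← Nat.cast_mul, ← Nat.descFactorial_eq_factorial_mul_choose]
  induction k with
  | zero => simp
  | succ k ih =>
    rw [Finset.prod_range_succ, ih, Nat.descFactorial_succ, Nat.cast_mul, mul_comm]
    rcases le_or_gt k a with h | h
    · rw [Nat.cast_sub h]
    · rw [Nat.descFactorial_of_lt h]; simp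

theorem sum_prod_area (n k : ℕ) :
    ∑ p ∈ parkingFunctions n, ∏ j ∈ Finset.range k, (area p - (j : ℝ)) =
      k.factorial * (areaPoly n).coeff k := by
  rw [coeff_areaPoly, Finset.mul_sum]
  refine Finset.sum_congr rfl fun p hp => ?_
  rw [area_eq_natArea hp, prod_sub_eq_choose]

theorem card_parkingFunctions_eq_coeff (n : ℕ) :
    ((parkingFunctions n).card : ℝ) = (areaPoly n).coeff 0 := by
  simp [coeff_areaPoly]

theorem factorialMoment_eq (k n : ℕ) :
    factorialMoment k n = k.factorial * (areaPoly n).coeff k / (areaPoly n).coeff 0 := by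
  rw [factorialMoment, expectation, sum_prod_area, card_parkingFunctions_eq_coeff]

theorem E₁_eq_factorialMoment (n : ℕ) : E₁ n = factorialMoment 1 n := by
  simp [E₁, factorialMoment]

/-! ### The convolution identity between area enumerators and graphs -/

section Kernel

open Polynomial

/-- Weights of the spots `1, …, n + 1` whose sums over final segments are powers of `1 + X`. -/
noncomputable def spotWeight (n j : ℕ) : ℝ[X] := if j ≤ n then X * (1 + X) ^ (n - j) else 1

theorem sum_spotWeight (n d : ℕ) : ∀ i, i + d = n →
    ∑ j ∈ Finset.Icc (i + 1) (n + 1), spotWeight n j = (1 + X) ^ d := by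
  induction d with
  | zero =>
    rintro i rfl
    simp [spotWeight]
  | succ d ih =>
    intro i hi
    have h : Finset.Icc (i + 1) (n + 1) = insert (i + 1) (Finset.Icc (i + 1 + 1) (n + 1)) := by
      ext j; simp only [Finset.mem_Icc, Finset.mem_insert]; omega
    rw [h, Finset.sum_insert (by simp), ih (i + 1) (by omega), spotWeight, if_pos (by omega),
      show n - (i + 1) = d by omega]
    ring

/-- Each parking function `p` has weight `X ^ i` times `1 + X` to the power `n * i - ∑ p`, and `∑ p`
is `(i + 1).choose 2` minus the area. The factor on the left avoids negative exponents. -/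
theorem parkSum_spotWeight {n i : ℕ} (hi : i ≤ n) :
    (1 + X) ^ ((i + 1).choose 2) * parkSum (spotWeight n) i =
      X ^ i * (1 + X) ^ (n * i) * areaPoly i := by
  rw [parkSum, areaPoly, Finset.mul_sum, Finset.mul_sum]
  refine Finset.sum_congr rfl fun p hp => ?_
  have hle : ∀ k, p k ≤ n := fun k =>
    (((mem_parkingFunctions p).1 hp).1 k).2.trans hi
  have h1 : ∏ k, spotWeight n (p k) = X ^ i * (1 + X) ^ (∑ k, (n - p k)) := by
    have hw : ∀ k, spotWeight n (p k) = X * (1 + X) ^ (n - p k) := fun k => if_pos (hle k)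
    rw [Finset.prod_congr rfl fun k _ => hw k, Finset.prod_mul_distrib,
      Finset.prod_const, Finset.card_univ, Fintype.card_fin, Finset.prod_pow_eq_pow_sum]
  have h2 : ∑ k, (n - p k) + ∑ k, p k = n * i := by
    rw [← Finset.sum_add_distrib, Finset.sum_congr rfl fun k _ => Nat.sub_add_cancel (hle k)]
    simp [mul_comm]
  have h3 : (i + 1).choose 2 + ∑ k, (n - p k) = n * i + natArea p := by
    have := sum_add_natArea hp
    omega
  rw [h1, mul_left_comm, ← pow_add, h3, pow_add, mul_assoc]

theorem one_add_X_ne_zero : (1 + X : ℝ[X]) ≠ 0 := by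
  rw [add_comm, ← C_1]; exact X_add_C_ne_zero _

/-- This is the first-empty-spot identity for `spotWeight n` with `n + 1` spots, after cancelling
powers of `1 + X`. In terms of graphs, it sorts the graphs on `n + 1` vertices by the component of a
marked vertex. -/
theorem sum_choose_areaPoly (n : ℕ) :
    ∑ i ∈ Finset.range (n + 1),
      (n.choose i : ℝ[X]) * (areaPoly i * X ^ i * (1 + X) ^ ((n - i).choose 2)) =
      (1 + X) ^ ((n + 1).choose 2) := by
  have h := sum_pow_eq_sum_parkSum (spotWeight n) (Nat.lt_succ_self n)
  rw [sum_spotWeight n n 0 (zero_add n), ← pow_mul] at h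
  have h1 : n * n = n.choose 2 + (n + 1).choose 2 := by
    have a := choose_two_identity n
    have b := choose_two_identity (n + 1)
    nlinarith
  refine mul_left_cancel₀ (pow_ne_zero (n.choose 2) one_add_X_ne_zero) ?_
  rw [← pow_add, ← h1, h, Finset.mul_sum]
  refine Finset.sum_congr rfl fun i hi => ?_
  rw [mul_left_comm]
  congr 1
  obtain ⟨d, rfl⟩ := Nat.exists_eq_add_of_le (Nat.lt_succ_iff.1 (Finset.mem_range.1 hi))
  -- For `d = 0` the tail sum is empty, and `0 ^ 0 = 1` agrees with the exponent `(0 - 1) * 0 = 0`.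
  have h2 : (∑ j ∈ Finset.Icc (i + 2) (i + d).succ, spotWeight (i + d) j) ^ (i + d - i) =
      (1 + X) ^ ((d - 1) * d) := by
    rw [Nat.add_sub_cancel_left, pow_mul]
    rcases d with _ | d
    · simp
    · rw [sum_spotWeight (i + (d + 1)) d (i + 1) (by ring), Nat.add_sub_cancel]
  rw [h2, Nat.add_sub_cancel_left]
  refine mul_left_cancel₀ (pow_ne_zero ((i + 1).choose 2) one_add_X_ne_zero) ?_
  symm
  rw [← mul_assoc, parkSum_spotWeight (Nat.le_add_right i d)]
  have h3 : (i + d) * i + (d - 1) * d = (i + 1).choose 2 + (i + d).choose 2 + d.choose 2 := by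
    have a := choose_two_identity (i + 1)
    have b := choose_two_identity (i + d)
    have c := choose_two_identity d
    have e : (d - 1) * d + d = d * d := by rcases d with _ | d <;> simp; ring
    nlinarith
  calc _ = X ^ i * areaPoly i * (1 + X) ^ ((i + d) * i + (d - 1) * d) := by rw [pow_add]; ring
    _ = _ := by rw [h3]; ring

end Kernel

/-! ### The differential equation in `x` and `X` -/

section CoefficientDerivative

theorem derivative_mul' {R : Type*} [CommRing R] (f g : PowerSeries R) :
    PowerSeries.derivative R (f * g) =
      PowerSeries.derivative R f * g + f * PowerSeries.derivative R g := by
  rw [Derivation.leibniz, smul_eq_mul, smul_eq_mul]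
  ring

/-- Differentiating the coefficients of a power series with polynomial coefficients. -/
noncomputable def coeffDeriv (f : PowerSeries (Polynomial ℝ)) : PowerSeries (Polynomial ℝ) :=
  PowerSeries.mk fun n => Polynomial.derivative (PowerSeries.coeff n f)

theorem coeff_coeffDeriv (f : PowerSeries (Polynomial ℝ)) (n : ℕ) :
    PowerSeries.coeff n (coeffDeriv f) = Polynomial.derivative (PowerSeries.coeff n f) :=
  PowerSeries.coeff_mk _ _

theorem coeffDeriv_mul (f g : PowerSeries (Polynomial ℝ)) :
    coeffDeriv (f * g) = coeffDeriv f * g + f * coeffDeriv g := by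
  ext1 n
  rw [coeff_coeffDeriv, map_add, PowerSeries.coeff_mul, PowerSeries.coeff_mul,
    PowerSeries.coeff_mul, Polynomial.derivative_sum, ← Finset.sum_add_distrib]
  refine Finset.sum_congr rfl fun _ _ => ?_
  rw [Polynomial.derivative_mul, coeff_coeffDeriv, coeff_coeffDeriv]

theorem coeffDeriv_derivative (f : PowerSeries (Polynomial ℝ)) :
    coeffDeriv (PowerSeries.derivative _ f) = PowerSeries.derivative _ (coeffDeriv f) := by
  ext1 n
  rw [coeff_coeffDeriv, PowerSeries.coeff_derivative, PowerSeries.coeff_derivative,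
    coeff_coeffDeriv, Polynomial.derivative_mul]
  have : Polynomial.derivative ((n : Polynomial ℝ) + 1) = 0 := by simp
  rw [this, mul_zero, add_zero]

end CoefficientDerivative

/-- The exponential generating function of all graphs, counted by edges in the variable
`1 + X`. -/
noncomputable def graphSeries : PowerSeries (Polynomial ℝ) :=
  PowerSeries.mk fun n =>
    Polynomial.C ((n.factorial : ℝ)⁻¹) * (1 + Polynomial.X) ^ (n.choose 2)

/-- The exponential generating function of `areaPoly n * X ^ n`. -/
noncomputable def areaSeries : PowerSeries (Polynomial ℝ) :=
  PowerSeries.mk fun n =>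
    Polynomial.C ((n.factorial : ℝ)⁻¹) * (areaPoly n * Polynomial.X ^ n)

theorem C_mul_cast_succ (n : ℕ) :
    Polynomial.C (((n + 1).factorial : ℝ)⁻¹) * ((n : Polynomial ℝ) + 1) =
      Polynomial.C ((n.factorial : ℝ)⁻¹) := by
  have h : ((n : Polynomial ℝ) + 1) = Polynomial.C ((n : ℝ) + 1) := by simp
  rw [h, ← Polynomial.C_mul]
  congr 1
  rw [Nat.factorial_succ]
  push_cast
  have : (n.factorial : ℝ) ≠ 0 := by positivity
  field_simp

theorem areaSeries_mul_graphSeries :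
    areaSeries * graphSeries = PowerSeries.derivative _ graphSeries := by
  ext1 n
  rw [PowerSeries.coeff_derivative, graphSeries, PowerSeries.coeff_mk, mul_right_comm,
    C_mul_cast_succ, ← sum_choose_areaPoly, PowerSeries.coeff_mul,
    Finset.Nat.sum_antidiagonal_eq_sum_range_succ_mk, Finset.mul_sum]
  refine Finset.sum_congr rfl fun i hi => ?_
  have hi' := Nat.lt_succ_iff.1 (Finset.mem_range.1 hi)
  have h : Polynomial.C ((n.factorial : ℝ)⁻¹) * (n.choose i : Polynomial ℝ) =
      Polynomial.C ((i.factorial : ℝ)⁻¹) * Polynomial.C (((n - i).factorial : ℝ)⁻¹) := by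
    rw [← Polynomial.C_eq_natCast, ← Polynomial.C_mul, ← Polynomial.C_mul, Nat.cast_choose ℝ hi']
    congr 1
    have h1 : (n.factorial : ℝ) ≠ 0 := by positivity
    field_simp
  rw [areaSeries, PowerSeries.coeff_mk, PowerSeries.coeff_mk]
  linear_combination (-(areaPoly i * Polynomial.X ^ i *
    (1 + Polynomial.X) ^ ((n - i).choose 2))) * h

/-- A heat equation: `(1 + X) * d/dX` multiplies `(1 + X) ^ n.choose 2` by `n.choose 2`, while `x ^
2 * d²/dx²` multiplies the coefficient of `x ^ n` by `n * (n - 1)`, twice as much. -/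
theorem coeffDeriv_graphSeries :
    2 * (PowerSeries.C (1 + Polynomial.X) * coeffDeriv graphSeries) =
      PowerSeries.X ^ 2 * PowerSeries.derivative _ (PowerSeries.derivative _ graphSeries) := by
  ext1 n
  have h2 : (2 : PowerSeries (Polynomial ℝ)) =
      PowerSeries.C (2 : Polynomial ℝ) := (map_ofNat _ 2).symm
  rw [h2, PowerSeries.coeff_C_mul, PowerSeries.coeff_C_mul, coeff_coeffDeriv, graphSeries,
    PowerSeries.coeff_mk, PowerSeries.coeff_X_pow_mul', Polynomial.derivative_C_mul,
    Polynomial.derivative_pow]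
  have hd : Polynomial.derivative (1 + Polynomial.X : Polynomial ℝ) = 1 := by simp
  rw [hd, mul_one]
  rcases n with _ | _ | n
  · simp
  · simp
  · rw [if_pos (by omega), show n + 1 + 1 - 2 = n from rfl, PowerSeries.coeff_derivative,
      PowerSeries.coeff_derivative, PowerSeries.coeff_mk]
    have h3 := choose_two_identity (n + 1 + 1)
    have h4 : (n + 1 + 1).choose 2 ≠ 0 := (Nat.choose_pos (by omega)).ne'
    have h5 : ((((n + 1 + 1).choose 2 * 2 + (n + 1 + 1) : ℕ)) : Polynomial ℝ) =
        ((n + 1 + 1) * (n + 1 + 1) : ℕ) := by rw [h3]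
    push_cast at h5
    obtain ⟨c, hc⟩ := Nat.exists_eq_succ_of_ne_zero h4
    rw [hc] at h5 ⊢
    push_cast at h5 ⊢
    simp only [Nat.succ_eq_add_one, map_add, map_natCast, map_one] at h5 ⊢
    linear_combination (Polynomial.C (((n + 1 + 1).factorial : ℝ)⁻¹) *
      (1 + Polynomial.X) ^ (c + 1)) * h5

theorem graphSeries_ne_zero : graphSeries ≠ 0 := fun h => by
  have := congrArg (PowerSeries.coeff 0) h
  simp [graphSeries] at this

/-- The differential equation for the exponential generating function of connected graphs. -/
theorem coeffDeriv_areaSeries :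
    2 * (PowerSeries.C (1 + Polynomial.X) * coeffDeriv areaSeries) =
      PowerSeries.derivative _ (PowerSeries.X ^ 2 *
        (PowerSeries.derivative _ areaSeries + areaSeries ^ 2)) := by
  have h1 := areaSeries_mul_graphSeries
  have h2 := coeffDeriv_graphSeries
  have h3 : PowerSeries.derivative _ (PowerSeries.derivative _ graphSeries) =
      (PowerSeries.derivative _ areaSeries + areaSeries ^ 2) * graphSeries := by
    rw [← h1, derivative_mul', ← h1]
    ring
  have h4 := congrArg coeffDeriv h1
  rw [coeffDeriv_mul, coeffDeriv_derivative] at h4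
  rw [h3] at h2
  have h5 := congrArg (PowerSeries.derivative _) h2
  have h6 : PowerSeries.derivative (Polynomial ℝ) (2 : PowerSeries (Polynomial ℝ)) = 0 := by
    rw [show (2 : PowerSeries (Polynomial ℝ)) = PowerSeries.C (2 : Polynomial ℝ) from
      (map_ofNat _ 2).symm, PowerSeries.derivative_C]
  rw [derivative_mul', derivative_mul' (PowerSeries.C _), h6, PowerSeries.derivative_C,
    ← mul_assoc (PowerSeries.X ^ 2), derivative_mul' (_ * _), ← h1, ← h4] at h5
  refine mul_right_cancel₀ graphSeries_ne_zero ?_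
  -- `h5` is the `x`-derivative of the heat equation with the product rule for `coeffDeriv`
  -- substituted; subtracting `areaSeries` times the heat equation removes `coeffDeriv graphSeries`,
  -- and `graphSeries` factors out of what remains.
  linear_combination h5 - areaSeries * h2

/-- Coefficient of `x ^ (n + 1)` in `coeffDeriv_areaSeries`, divided by the common factor `X ^ n`.
-/
theorem areaPoly_equation (n : ℕ) :
    2 * ((1 + Polynomial.X) * (Polynomial.C (((n + 1).factorial : ℝ)⁻¹) *
      (((n : Polynomial ℝ) + 1) * areaPoly (n + 1)
        + Polynomial.X * Polynomial.derivative (areaPoly (n + 1))))) =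
      ((n : Polynomial ℝ) + 2) * (((n : Polynomial ℝ) + 1) *
        (Polynomial.C (((n + 1).factorial : ℝ)⁻¹) * (Polynomial.X * areaPoly (n + 1)))
        + ∑ ij ∈ Finset.HasAntidiagonal.antidiagonal n, (Polynomial.C ((ij.1.factorial : ℝ)⁻¹) * areaPoly ij.1) *
          (Polynomial.C ((ij.2.factorial : ℝ)⁻¹) * areaPoly ij.2)) := by
  have h := congrArg (PowerSeries.coeff (n + 1)) coeffDeriv_areaSeries
  have h2 : (2 : PowerSeries (Polynomial ℝ)) =
      PowerSeries.C (2 : Polynomial ℝ) := (map_ofNat _ 2).symm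
  have h3 : PowerSeries.coeff n (areaSeries ^ 2) = Polynomial.X ^ n *
      ∑ ij ∈ Finset.HasAntidiagonal.antidiagonal n, (Polynomial.C ((ij.1.factorial : ℝ)⁻¹) * areaPoly ij.1) *
          (Polynomial.C ((ij.2.factorial : ℝ)⁻¹) * areaPoly ij.2) := by
    rw [pow_two, PowerSeries.coeff_mul, Finset.mul_sum]
    refine Finset.sum_congr rfl fun ij hij => ?_
    rw [← Finset.HasAntidiagonal.mem_antidiagonal.1 hij, areaSeries, PowerSeries.coeff_mk, PowerSeries.coeff_mk]
    ring
  rw [h2, PowerSeries.coeff_C_mul, PowerSeries.coeff_C_mul, coeff_coeffDeriv,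
    PowerSeries.coeff_derivative, show n + 1 + 1 = n + 2 from rfl, PowerSeries.coeff_X_pow_mul,
    map_add, PowerSeries.coeff_derivative, h3, areaSeries, PowerSeries.coeff_mk,
    Polynomial.derivative_C_mul, Polynomial.derivative_mul, Polynomial.derivative_X_pow] at h
  refine mul_left_cancel₀ (pow_ne_zero n Polynomial.X_ne_zero) ?_
  simp only [Nat.add_sub_cancel, map_natCast] at h
  push_cast at h
  linear_combination h

/-! ### Recurrence for the moment series -/

/-- The number of pairs of a parking function and a `k`-subset of its area, divided by `n!`. -/
noncomputable def areaCoeff (k n : ℕ) : ℝ := (areaPoly n).coeff k / n.factorial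

/-- The exponential generating function of the coefficients of `areaPoly`. -/
noncomputable def momentSeries (k : ℕ) : PowerSeries ℝ := PowerSeries.mk (areaCoeff k)

theorem areaCoeff_recurrence (k n : ℕ) :
    2 * (((n : ℝ) + 1 + (k + 1)) * areaCoeff (k + 1) (n + 1)
      + ((n : ℝ) + 1 + k) * areaCoeff k (n + 1)) =
      ((n : ℝ) + 2) * (((n : ℝ) + 1) * areaCoeff k (n + 1)
        + ∑ ij ∈ Finset.HasAntidiagonal.antidiagonal n, ∑ ab ∈ Finset.HasAntidiagonal.antidiagonal (k + 1),
          areaCoeff ab.1 ij.1 * areaCoeff ab.2 ij.2) := by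
  have h := congrArg (fun p => Polynomial.coeff p (k + 1)) (areaPoly_equation n)
  have e2 : (2 : Polynomial ℝ) = Polynomial.C 2 := (map_ofNat _ 2).symm
  have e3 : (n : Polynomial ℝ) + 1 = Polynomial.C ((n : ℝ) + 1) := by simp
  have e4 : (n : Polynomial ℝ) + Polynomial.C 2 = Polynomial.C ((n : ℝ) + 2) := by simp
  simp only [e2, e3, e4, add_mul, one_mul, Polynomial.coeff_add, Polynomial.coeff_C_mul,
    Polynomial.coeff_X_mul, Polynomial.finsetSum_coeff, Polynomial.coeff_mul (_ * _),
    Polynomial.coeff_derivative] at h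
  rcases k with _ | k
  · simp [areaCoeff, div_eq_inv_mul, Polynomial.coeff_derivative] at h ⊢
    linear_combination h
  · simp [areaCoeff, Polynomial.coeff_X_mul, div_eq_inv_mul, Polynomial.coeff_derivative] at h ⊢
    linear_combination h

theorem parkingFunctions_zero : parkingFunctions 0 = {default} := by
  ext p
  rw [mem_parkingFunctions, Finset.mem_singleton]
  exact ⟨fun _ => Subsingleton.elim _ _, fun _ => ⟨fun i => i.elim0, fun i => i.elim0⟩⟩

theorem areaPoly_zero : areaPoly 0 = 1 := by
  simp [areaPoly, parkingFunctions_zero, natArea]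

theorem areaCoeff_zero_right (k : ℕ) (hk : k ≠ 0) : areaCoeff k 0 = 0 := by
  simp [areaCoeff, areaPoly_zero, Polynomial.coeff_one, hk]

/-- The Euler operator `x d/dx` on power series. -/
noncomputable def euler (f : PowerSeries ℝ) : PowerSeries ℝ :=
  PowerSeries.X * PowerSeries.derivative ℝ f

theorem coeff_euler (f : PowerSeries ℝ) (n : ℕ) :
    PowerSeries.coeff n (euler f) = n * PowerSeries.coeff n f := by
  rcases n with _ | n
  · simp [euler]
  · rw [euler, PowerSeries.coeff_succ_X_mul, PowerSeries.coeff_derivative]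
    push_cast
    ring

theorem euler_mul (f g : PowerSeries ℝ) : euler (f * g) = euler f * g + f * euler g := by
  rw [euler, derivative_mul', euler, euler]
  ring

theorem euler_add (f g : PowerSeries ℝ) : euler (f + g) = euler f + euler g := by
  rw [euler, map_add, mul_add, euler, euler]

theorem euler_sub (f g : PowerSeries ℝ) : euler (f - g) = euler f - euler g := by
  rw [euler, map_sub, mul_sub, euler, euler]

theorem euler_one : euler 1 = 0 := by simp [euler]

theorem euler_X : euler PowerSeries.X = PowerSeries.X := by simp [euler]

theorem coeff_momentSeries (k n : ℕ) : PowerSeries.coeff n (momentSeries k) = areaCoeff k n :=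
  PowerSeries.coeff_mk _ _

theorem momentSeries_equation (k : ℕ) :
    2 * (euler (momentSeries (k + 1)) + ((k : PowerSeries ℝ) + 1) * momentSeries (k + 1)
      + euler (momentSeries k) + (k : PowerSeries ℝ) * momentSeries k) =
    euler (euler (momentSeries k)) + euler (momentSeries k)
      + (euler (PowerSeries.X * ∑ ab ∈ Finset.HasAntidiagonal.antidiagonal (k + 1),
          momentSeries ab.1 * momentSeries ab.2)
        + PowerSeries.X * ∑ ab ∈ Finset.HasAntidiagonal.antidiagonal (k + 1),
          momentSeries ab.1 * momentSeries ab.2) := by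
  ext n
  have e2 : (2 : PowerSeries ℝ) = PowerSeries.C (2 : ℝ) := (map_ofNat _ 2).symm
  have ek : (k : PowerSeries ℝ) = PowerSeries.C (k : ℝ) := (map_natCast _ k).symm
  have ek1 : PowerSeries.C (k : ℝ) + 1 = PowerSeries.C ((k : ℝ) + 1) := by simp
  rw [e2, ek, ek1, PowerSeries.coeff_C_mul]
  simp only [map_add (PowerSeries.coeff n), PowerSeries.coeff_C_mul, coeff_euler,
    coeff_momentSeries]
  rcases n with _ | n
  · have h : (k : ℝ) * areaCoeff k 0 = 0 := by
      rcases eq_or_ne k 0 with rfl | hk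
      · simp
      · rw [areaCoeff_zero_right k hk, mul_zero]
    simp [areaCoeff_zero_right (k + 1) (Nat.succ_ne_zero k), h]
  · have h := areaCoeff_recurrence k n
    have hs : PowerSeries.coeff n (∑ ab ∈ Finset.HasAntidiagonal.antidiagonal (k + 1),
        momentSeries ab.1 * momentSeries ab.2) =
        ∑ ij ∈ Finset.HasAntidiagonal.antidiagonal n,
          ∑ ab ∈ Finset.HasAntidiagonal.antidiagonal (k + 1),
          areaCoeff ab.1 ij.1 * areaCoeff ab.2 ij.2 := by
      rw [map_sum, Finset.sum_comm]
      simp only [PowerSeries.coeff_mul, coeff_momentSeries]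
    rw [PowerSeries.coeff_succ_X_mul, hs]
    push_cast
    linear_combination h

/-! ### Abel series and the tree function -/

/-- The series `∑ (n + b) ^ n / n! x ^ n`. -/
noncomputable def abelSeries (b : ℕ) : PowerSeries ℝ :=
  PowerSeries.mk fun n => ((n : ℝ) + b) ^ n / n.factorial

theorem parkSum_one (n : ℕ) : parkSum (fun _ => (1 : ℝ)) n = (areaPoly n).coeff 0 := by
  simp [parkSum, ← card_parkingFunctions_eq_coeff]

/-- The first-empty-spot identity with unit weights, for `n` cars and `n + b + 1` spots: if `i` cars
park before the first empty spot, then `n - i + b` spots lie beyond it. -/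
theorem abelSeries_succ (b : ℕ) : abelSeries (b + 1) = momentSeries 0 * abelSeries b := by
  ext n
  have h := sum_pow_eq_sum_parkSum (fun _ => (1 : ℝ)) (show n < n + b + 1 by omega)
  rw [abelSeries, PowerSeries.coeff_mk, PowerSeries.coeff_mul,
    Finset.Nat.sum_antidiagonal_eq_sum_range_succ_mk]
  have hn : (n.factorial : ℝ) ≠ 0 := by positivity
  rw [div_eq_iff hn]
  have h0 : ((n : ℝ) + ((b + 1 : ℕ) : ℝ)) ^ n = (∑ j ∈ Finset.Icc 1 (n + b + 1), (1 : ℝ)) ^ n := by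
    simp [add_assoc]
  rw [h0, h, Finset.sum_mul]
  refine Finset.sum_congr rfl fun i hi => ?_
  have hi' := Nat.lt_succ_iff.1 (Finset.mem_range.1 hi)
  rw [parkSum_one, coeff_momentSeries, areaCoeff, abelSeries, PowerSeries.coeff_mk,
    Nat.cast_choose ℝ hi', Finset.sum_const, Nat.card_Icc,
    show n + b + 1 + 1 - (i + 2) = n - i + b by omega, nsmul_eq_mul, mul_one]
  push_cast
  field_simp

theorem abelSeries_zero : abelSeries 0 = 1 + PowerSeries.X * abelSeries 1 := by
  ext n
  rcases n with _ | n
  · simp [abelSeries]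
  · rw [map_add, PowerSeries.coeff_succ_X_mul, abelSeries, abelSeries, PowerSeries.coeff_mk,
      PowerSeries.coeff_mk, PowerSeries.coeff_one, if_neg n.succ_ne_zero, Nat.factorial_succ]
    have : (n.factorial : ℝ) ≠ 0 := by positivity
    push_cast
    field_simp
    ring

/-- The series `T / (1 - T)`, where `T` is the tree function. -/
noncomputable def treeVar : PowerSeries ℝ := PowerSeries.X * abelSeries 1

theorem momentSeries_zero_mul : momentSeries 0 * (1 + treeVar) = abelSeries 1 := by
  rw [treeVar, ← abelSeries_zero, ← abelSeries_succ]

theorem X_mul_momentSeries_zero_mul :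
    PowerSeries.X * momentSeries 0 * (1 + treeVar) = treeVar := by
  rw [mul_assoc, momentSeries_zero_mul, treeVar]

/-- Solving `momentSeries 0 * (1 + x * abelSeries 1) = abelSeries 1` gives `abelSeries 1 - x *
abelSeries 2`, whose coefficients are `((n + 1) ^ n - n * (n + 1) ^ (n - 1)) / n!`. -/
theorem momentSeries_zero_eq :
    momentSeries 0 = PowerSeries.mk fun n => ((n : ℝ) + 1) ^ (n - 1) / n.factorial := by
  have h1 : momentSeries 0 = abelSeries 1 - PowerSeries.X * abelSeries 2 := by
    rw [abelSeries_succ 1]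
    have a := momentSeries_zero_mul
    rw [treeVar] at a
    linear_combination a
  rw [h1]
  ext n
  rcases n with _ | n
  · simp [abelSeries]
  · rw [map_sub, PowerSeries.coeff_succ_X_mul, abelSeries, abelSeries, PowerSeries.coeff_mk,
      PowerSeries.coeff_mk, PowerSeries.coeff_mk, Nat.factorial_succ, Nat.add_sub_cancel]
    have : (n.factorial : ℝ) ≠ 0 := by positivity
    push_cast
    field_simp
    ring

theorem areaCoeff_zero_left (n : ℕ) :
    areaCoeff 0 n = ((n : ℝ) + 1) ^ (n - 1) / n.factorial := by
  rw [← coeff_momentSeries, momentSeries_zero_eq, PowerSeries.coeff_mk]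

theorem euler_momentSeries_zero : euler (momentSeries 0) = momentSeries 0 * treeVar := by
  have h : euler (momentSeries 0) = abelSeries 1 - momentSeries 0 := by
    ext n
    rw [coeff_euler, map_sub, momentSeries_zero_eq, PowerSeries.coeff_mk, abelSeries,
      PowerSeries.coeff_mk]
    rcases n with _ | n
    · simp
    · rw [Nat.add_sub_cancel]
      push_cast
      ring
  rw [h, ← momentSeries_zero_mul]
  ring

/-- The Euler operator is applied to the implicit equation `x * momentSeries 0 * (1 + treeVar) =
treeVar`, and the result is solved for `euler treeVar`. -/
theorem euler_treeVar : euler treeVar = treeVar * (1 + treeVar) ^ 2 := by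
  have h1 := X_mul_momentSeries_zero_mul
  have h2 := congrArg euler h1
  rw [euler_mul, euler_mul, euler_X, euler_momentSeries_zero, euler_add, euler_one,
    zero_add] at h2
  linear_combination (-(1 + treeVar)) * h2 + (euler treeVar + (1 + treeVar) ^ 2) * h1

/-! ### Moment series as polynomials in the tree variable -/

section TreePolynomials

open Polynomial

/-- The operator on polynomials in `treeVar` that corresponds to the Euler operator on their
products with `momentSeries 0`. -/
noncomputable def treeEuler (p : ℝ[X]) : ℝ[X] := X * p + X * (X + 1) ^ 2 * derivative p

theorem euler_aeval_treeVar (p : ℝ[X]) :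
    euler (aeval treeVar p) = treeVar * (1 + treeVar) ^ 2 * aeval treeVar (derivative p) := by
  have h : euler (aeval treeVar p) = aeval treeVar (derivative p) * euler treeVar := by
    rw [euler, euler, Derivation.map_aeval, smul_eq_mul]
    ring
  rw [h, euler_treeVar]
  ring

/-- The product of `momentSeries 0` with a polynomial in `treeVar`. -/
noncomputable def treeSeries (p : ℝ[X]) : PowerSeries ℝ := momentSeries 0 * aeval treeVar p

theorem euler_treeSeries (p : ℝ[X]) : euler (treeSeries p) = treeSeries (treeEuler p) := by
  rw [treeSeries, euler_mul, euler_momentSeries_zero, euler_aeval_treeVar, treeSeries, treeEuler]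
  simp only [map_add, map_mul, map_pow, aeval_X, map_one]
  ring

/-- The extra copy of the series makes the result divisible by `1 + treeVar`: with `r = p * q` the
left side is `x * M ^ 2 * (2 * (1 + t) * r + t * (1 + t) ^ 2 * r')`, and `x * M * (1 + t) = t`
brings it back to `M` times a polynomial in `t`. -/
theorem euler_X_mul_treeSeries (p q : ℝ[X]) :
    euler (PowerSeries.X * (treeSeries p * treeSeries q))
      + PowerSeries.X * (treeSeries p * treeSeries q) =
      treeSeries (X * (2 * (p * q) + X * (X + 1) * derivative (p * q))) := by
  have h : treeSeries p * treeSeries q =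
      momentSeries 0 * momentSeries 0 * aeval treeVar (p * q) := by
    rw [treeSeries, treeSeries, map_mul]; ring
  rw [h, euler_mul, euler_mul, euler_mul, euler_X, euler_momentSeries_zero, euler_aeval_treeVar,
    treeSeries]
  simp only [map_add, map_mul (aeval treeVar) X, map_mul (aeval treeVar) (X * _),
    map_mul (aeval treeVar) 2, aeval_X, map_one, map_ofNat]
  linear_combination (momentSeries 0 * (2 * aeval treeVar (p * q) + treeVar * (1 + treeVar) *
    aeval treeVar (derivative (p * q)))) * X_mul_momentSeries_zero_mul

/-- The coefficient of `x ^ n` on the right involves only earlier coefficients of `f`, while on the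
left that of `f` is multiplied by `n + k + 1 ≠ 0`. This is the uniqueness statement for the moment
equation. -/
theorem eq_zero_of_euler_eq (k : ℕ) (f : PowerSeries ℝ)
    (h : euler f + ((k : PowerSeries ℝ) + 1) * f =
      euler (PowerSeries.X * (momentSeries 0 * f)) + PowerSeries.X * (momentSeries 0 * f)) :
    f = 0 := by
  ext n
  induction n using Nat.strong_induction_on with
  | _ n ih =>
    have h1 := congrArg (PowerSeries.coeff n) h
    have h2 : PowerSeries.coeff n (PowerSeries.X * (momentSeries 0 * f)) = 0 := by
      rcases n with _ | n
      · simp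
      · rw [PowerSeries.coeff_succ_X_mul, PowerSeries.coeff_mul]
        refine Finset.sum_eq_zero fun ij hij => ?_
        have := Finset.HasAntidiagonal.mem_antidiagonal.1 hij
        rw [ih ij.2 (by omega), map_zero, mul_zero]
    have ek : (k : PowerSeries ℝ) + 1 = PowerSeries.C ((k : ℝ) + 1) := by simp
    rw [map_add, map_add, coeff_euler, coeff_euler, h2, ek, PowerSeries.coeff_C_mul, mul_zero,
      add_zero, ← add_mul] at h1
    rw [map_zero]
    exact (mul_eq_zero.1 h1).resolve_left (by positivity)

theorem treeSeries_sum {ι : Type*} (s : Finset ι) (f : ι → ℝ[X]) :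
    treeSeries (∑ i ∈ s, f i) = ∑ i ∈ s, treeSeries (f i) := by
  simp only [treeSeries, map_sum, Finset.mul_sum]

theorem treeSeries_add (p q : ℝ[X]) : treeSeries (p + q) = treeSeries p + treeSeries q := by
  simp only [treeSeries, map_add, mul_add]

/-- The polynomial `X * (2 * p + X * (X + 1) * p')`. -/
noncomputable def quadOp (p : ℝ[X]) : ℝ[X] := X * (2 * p + X * (X + 1) * derivative p)

theorem quadOp_sum {ι : Type*} (s : Finset ι) (f : ι → ℝ[X]) :
    quadOp (∑ i ∈ s, f i) = ∑ i ∈ s, quadOp (f i) := by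
  simp only [quadOp, derivative_sum, Finset.mul_sum, ← Finset.sum_add_distrib]

theorem euler_sum {ι : Type*} (s : Finset ι) (f : ι → PowerSeries ℝ) :
    euler (∑ i ∈ s, f i) = ∑ i ∈ s, euler (f i) := by
  simp only [euler, map_sum, Finset.mul_sum]

theorem momentSeries_succ_eq_treeSeries (k : ℕ) (r : ℕ → ℝ[X]) (h0 : r 0 = 1)
    (hr : ∀ j ≤ k, momentSeries j = treeSeries (r j))
    (h : 2 * (treeEuler (r (k + 1)) + ((k : ℝ[X]) + 1) * r (k + 1) + treeEuler (r k)
        + (k : ℝ[X]) * r k) =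
      treeEuler (treeEuler (r k)) + treeEuler (r k)
        + quadOp (∑ ab ∈ Finset.HasAntidiagonal.antidiagonal (k + 1), r ab.1 * r ab.2)) :
    momentSeries (k + 1) = treeSeries (r (k + 1)) := by
  have h1 := momentSeries_equation k
  have h2 : ∀ p, treeSeries p = momentSeries 0 * aeval treeVar p := fun p => rfl
  have h3 : 2 * (euler (treeSeries (r (k + 1))) + ((k : PowerSeries ℝ) + 1) *
        treeSeries (r (k + 1)) + euler (treeSeries (r k)) + (k : PowerSeries ℝ) *
        treeSeries (r k)) =
      euler (euler (treeSeries (r k))) + euler (treeSeries (r k))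
      + (euler (PowerSeries.X * ∑ ab ∈ Finset.HasAntidiagonal.antidiagonal (k + 1),
          treeSeries (r ab.1) * treeSeries (r ab.2))
        + PowerSeries.X * ∑ ab ∈ Finset.HasAntidiagonal.antidiagonal (k + 1),
          treeSeries (r ab.1) * treeSeries (r ab.2)) := by
    have h4 := congrArg treeSeries h
    rw [quadOp_sum, treeSeries_add, treeSeries_add, treeSeries_sum] at h4
    rw [Finset.mul_sum, euler_sum, ← Finset.sum_add_distrib,
      Finset.sum_congr rfl fun ab _ => euler_X_mul_treeSeries (r ab.1) (r ab.2)]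
    simp only [euler_treeSeries]
    refine Eq.trans ?_ h4
    simp only [treeSeries, map_add, map_mul, map_natCast, map_one, map_ofNat]
    ring
  -- Only the two end terms of the convolution contain the unknown of index `k + 1`. The remaining
  -- terms agree for both solutions, so their difference satisfies the homogeneous linear equation.
  have h5 : ∀ u : ℕ → PowerSeries ℝ, ∑ ab ∈ Finset.HasAntidiagonal.antidiagonal (k + 1),
      u ab.1 * u ab.2 = 2 * (u 0 * u (k + 1)) +
        ∑ i ∈ Finset.range k, u (i + 1) * u (k - i) := fun u => by
    rw [Finset.Nat.sum_antidiagonal_eq_sum_range_succ_mk, Finset.sum_range_succ,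
      Finset.sum_range_succ']
    simp only [Nat.sub_self, Nat.sub_zero, Nat.add_sub_add_right]
    ring
  have h6 : ∑ i ∈ Finset.range k, momentSeries (i + 1) * momentSeries (k - i) =
      ∑ i ∈ Finset.range k, treeSeries (r (i + 1)) * treeSeries (r (k - i)) :=
    Finset.sum_congr rfl fun i hi => by
      have := Finset.mem_range.1 hi
      rw [hr _ (by omega), hr _ (by omega)]
  have h7 : treeSeries (r 0) = momentSeries 0 := by rw [h0, h2, map_one, mul_one]
  rw [h5 momentSeries, h6, hr k le_rfl] at h1
  rw [h5 fun j => treeSeries (r j), h7] at h3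
  rw [← sub_eq_zero]
  refine eq_zero_of_euler_eq k _ ?_
  have e2 : euler (2 : PowerSeries ℝ) = 0 := by
    rw [← one_add_one_eq_two, euler_add, euler_one, add_zero]
  have h8 : (2 : PowerSeries ℝ) ≠ 0 := by
    rw [show (2 : PowerSeries ℝ) = PowerSeries.C (2 : ℝ) from (map_ofNat _ 2).symm]
    exact (map_ne_zero_iff _ PowerSeries.C_injective).2 two_ne_zero
  refine mul_left_cancel₀ h8 ?_
  simp only [euler_mul, euler_add, euler_sub, e2] at h1 h3 ⊢
  linear_combination h1 - h3

theorem coeff_treeSeries_treeEuler (p : ℝ[X]) (n : ℕ) :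
    PowerSeries.coeff n (treeSeries (treeEuler p)) = n * PowerSeries.coeff n (treeSeries p) := by
  rw [← euler_treeSeries, coeff_euler]

theorem coeff_treeSeries_C_mul (a : ℝ) (p : ℝ[X]) (n : ℕ) :
    PowerSeries.coeff n (treeSeries (C a * p)) = a * PowerSeries.coeff n (treeSeries p) := by
  rw [treeSeries, map_mul (aeval treeVar), aeval_C, mul_left_comm, ← Algebra.smul_def, map_smul,
    smul_eq_mul, treeSeries]

/-- The series `∑ (∑_{k ≤ n} (n + b) ^ k / k!) x ^ n`. -/
noncomputable def partialExpSeries (b : ℕ) : PowerSeries ℝ :=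
  PowerSeries.mk fun n => ∑ k ∈ Finset.range (n + 1), ((n : ℝ) + b) ^ k / k.factorial

/-- The term `k = n` of the inner sum gives the Abel series; the rest is the same sum with `n`
lowered and `b` raised by one. -/
theorem partialExpSeries_eq (b : ℕ) :
    partialExpSeries b = abelSeries b + PowerSeries.X * partialExpSeries (b + 1) := by
  ext n
  rcases n with _ | n
  · simp [partialExpSeries, abelSeries]
  · rw [map_add, PowerSeries.coeff_succ_X_mul, partialExpSeries, partialExpSeries, abelSeries,
      PowerSeries.coeff_mk, PowerSeries.coeff_mk, PowerSeries.coeff_mk, Finset.sum_range_succ,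
      add_comm]
    push_cast
    simp only [add_assoc, add_comm (1 : ℝ)]

theorem partialExpSeries_one : partialExpSeries 1 = momentSeries 0 * (1 + treeVar) ^ 2 := by
  have h1 : ∀ b, abelSeries (b + 1) = momentSeries 0 ^ b * abelSeries 1 := fun b => by
    induction b with
    | zero => simp
    | succ b ih => rw [abelSeries_succ (b + 1), ih]; ring
  -- The difference for `b` is `x` times the difference for `b + 1`, so the coefficients vanish by
  -- induction on `n`, for all `b` at once.
  have h2 : ∀ n b, PowerSeries.coeff n (partialExpSeries (b + 1)
      - momentSeries 0 ^ b * abelSeries 1 * (1 + treeVar)) = 0 := by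
    intro n
    induction n with
    | zero => intro b; simp [partialExpSeries, treeVar, abelSeries, momentSeries_zero_eq]
    | succ n ih =>
      intro b
      have h3 : partialExpSeries (b + 1) - momentSeries 0 ^ b * abelSeries 1 * (1 + treeVar) =
          PowerSeries.X * (partialExpSeries (b + 1 + 1)
            - momentSeries 0 ^ (b + 1) * abelSeries 1 * (1 + treeVar)) := by
        rw [partialExpSeries_eq (b + 1), h1]
        linear_combination (momentSeries 0 ^ b * abelSeries 1) * X_mul_momentSeries_zero_mul
      rw [h3, PowerSeries.coeff_succ_X_mul, ih]
  have h4 : partialExpSeries (0 + 1) - momentSeries 0 ^ 0 * abelSeries 1 * (1 + treeVar) = 0 :=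
    PowerSeries.ext fun n => by rw [h2, map_zero]
  rw [← momentSeries_zero_mul] at h4
  linear_combination h4

/-- From `t ^ 2 = (1 + t) ^ 2 - 2 * (1 + t) + 1`: after multiplication by `momentSeries 0`, each
term is a series with known coefficients. -/
theorem coeff_treeSeries_X_sq (n : ℕ) :
    PowerSeries.coeff n (treeSeries (X ^ 2)) = ∑ k ∈ Finset.range (n + 1),
      ((n : ℝ) + 1) ^ k / k.factorial - 2 * (((n : ℝ) + 1) ^ n / n.factorial)
        + ((n : ℝ) + 1) ^ (n - 1) / n.factorial := by
  have h : treeSeries (X ^ 2) =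
      partialExpSeries 1 - PowerSeries.C 2 * abelSeries 1 + momentSeries 0 := by
    rw [partialExpSeries_one, ← momentSeries_zero_mul, treeSeries, map_pow, aeval_X,
      show PowerSeries.C (2 : ℝ) = 2 from map_ofNat _ 2]
    ring
  rw [h, map_add, map_sub, PowerSeries.coeff_C_mul, coeff_momentSeries, areaCoeff_zero_left,
    partialExpSeries, abelSeries, PowerSeries.coeff_mk, PowerSeries.coeff_mk]
  push_cast
  ring

end TreePolynomials

/-! ### Explicit polynomials for the first six moments -/

section ExplicitPolynomials

open Polynomial

/-- The polynomials `p` with `momentSeries k = treeSeries p`, for `k ≤ 6`. -/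
noncomputable def areaTree : ℕ → ℝ[X]
  | 0 => 1
  | 1 => C (1 / 2) * (X ^ 2)
  | 2 => C (1 / 24) * (X ^ 3 * (24 + 37 * X + 15 * X ^ 2))
  | 3 => C (1 / 48) * (X ^ 3 * (8 + 184 * X + 546 * X ^ 2 + 677 * X ^ 3 + 395 * X ^ 4 +
      90 * X ^ 5))
  | 4 => C (1 / 5760) * (X ^ 4 * (10800 + 140160 * X + 554088 * X ^ 2 + 1099800 * X ^ 3 +
      1256655 * X ^ 4 + 845585 * X ^ 5 + 313575 * X ^ 6 + 49725 * X ^ 7))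
  | 5 => C (1 / 11520) * (X ^ 4 * (4800 + 244512 * X + 2553408 * X ^ 2 + 11663744 * X ^ 3 +
      30334200 * X ^ 4 + 50015416 * X ^ 5 + 54591755 * X ^ 6 + 39608625 * X ^ 7 +
      18467275 * X ^ 8 + 5029125 * X ^ 9 + 610200 * X ^ 10))
  | 6 => C (1 / 2903040) * (X ^ 4 * (120960 + 31933440 * X + 814786560 * X ^ 2 +
      7639075584 * X ^ 3 + 37938764880 * X ^ 4 + 117436331376 * X ^ 5 + 245814246720 * X ^ 6 +
      362804508864 * X ^ 7 + 384355355825 * X ^ 8 + 292009249175 * X ^ 9 + 155862961170 * X ^ 10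
      + 55659432150 * X ^ 11 + 11968297425 * X ^ 12 + 1174044375 * X ^ 13))
  | _ => 0

theorem momentSeries_zero_eq_treeSeries : momentSeries 0 = treeSeries (areaTree 0) := by
  rw [treeSeries, areaTree, map_one, mul_one]

theorem areaTree_equation_one :
    2 * (treeEuler (areaTree 1) + (((0 : ℕ) : ℝ[X]) + 1) * areaTree 1 + treeEuler (areaTree 0)
        + ((0 : ℕ) : ℝ[X]) * areaTree 0) =
      treeEuler (treeEuler (areaTree 0)) + treeEuler (areaTree 0)
        + quadOp (∑ ab ∈ Finset.HasAntidiagonal.antidiagonal (0 + 1),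
          areaTree ab.1 * areaTree ab.2) := by
  -- Evaluating at a real point turns the identity, derivatives included, into one that `ring` can
  -- check.
  refine Polynomial.funext fun x => ?_
  simp [areaTree, treeEuler, quadOp, Finset.Nat.antidiagonal_succ, derivative_pow]
  ring

theorem areaTree_equation_two :
    2 * (treeEuler (areaTree 2) + (((1 : ℕ) : ℝ[X]) + 1) * areaTree 2 + treeEuler (areaTree 1)
        + ((1 : ℕ) : ℝ[X]) * areaTree 1) =
      treeEuler (treeEuler (areaTree 1)) + treeEuler (areaTree 1)
        + quadOp (∑ ab ∈ Finset.HasAntidiagonal.antidiagonal (1 + 1),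
          areaTree ab.1 * areaTree ab.2) := by
  refine Polynomial.funext fun x => ?_
  simp [areaTree, treeEuler, quadOp, Finset.Nat.antidiagonal_succ, derivative_pow]
  ring

theorem areaTree_equation_three :
    2 * (treeEuler (areaTree 3) + (((2 : ℕ) : ℝ[X]) + 1) * areaTree 3 + treeEuler (areaTree 2)
        + ((2 : ℕ) : ℝ[X]) * areaTree 2) =
      treeEuler (treeEuler (areaTree 2)) + treeEuler (areaTree 2)
        + quadOp (∑ ab ∈ Finset.HasAntidiagonal.antidiagonal (2 + 1),
          areaTree ab.1 * areaTree ab.2) := by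
  refine Polynomial.funext fun x => ?_
  simp [areaTree, treeEuler, quadOp, Finset.Nat.antidiagonal_succ, derivative_pow]
  ring

theorem areaTree_equation_four :
    2 * (treeEuler (areaTree 4) + (((3 : ℕ) : ℝ[X]) + 1) * areaTree 4 + treeEuler (areaTree 3)
        + ((3 : ℕ) : ℝ[X]) * areaTree 3) =
      treeEuler (treeEuler (areaTree 3)) + treeEuler (areaTree 3)
        + quadOp (∑ ab ∈ Finset.HasAntidiagonal.antidiagonal (3 + 1),
          areaTree ab.1 * areaTree ab.2) := by
  refine Polynomial.funext fun x => ?_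
  simp [areaTree, treeEuler, quadOp, Finset.Nat.antidiagonal_succ, derivative_pow]
  ring

theorem areaTree_equation_five :
    2 * (treeEuler (areaTree 5) + (((4 : ℕ) : ℝ[X]) + 1) * areaTree 5 + treeEuler (areaTree 4)
        + ((4 : ℕ) : ℝ[X]) * areaTree 4) =
      treeEuler (treeEuler (areaTree 4)) + treeEuler (areaTree 4)
        + quadOp (∑ ab ∈ Finset.HasAntidiagonal.antidiagonal (4 + 1),
          areaTree ab.1 * areaTree ab.2) := by
  refine Polynomial.funext fun x => ?_
  simp [areaTree, treeEuler, quadOp, Finset.Nat.antidiagonal_succ, derivative_pow]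
  ring

theorem areaTree_equation_six :
    2 * (treeEuler (areaTree 6) + (((5 : ℕ) : ℝ[X]) + 1) * areaTree 6 + treeEuler (areaTree 5)
        + ((5 : ℕ) : ℝ[X]) * areaTree 5) =
      treeEuler (treeEuler (areaTree 5)) + treeEuler (areaTree 5)
        + quadOp (∑ ab ∈ Finset.HasAntidiagonal.antidiagonal (5 + 1),
          areaTree ab.1 * areaTree ab.2) := by
  refine Polynomial.funext fun x => ?_
  simp [areaTree, treeEuler, quadOp, Finset.Nat.antidiagonal_succ, derivative_pow]
  ring

theorem momentSeries_eq_treeSeries {k : ℕ} (hk : k ≤ 6) :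
    momentSeries k = treeSeries (areaTree k) := by
  induction k using Nat.strong_induction_on with
  | _ k ih =>
    rcases k with _ | k
    · exact momentSeries_zero_eq_treeSeries
    · refine momentSeries_succ_eq_treeSeries k areaTree rfl (fun j hj => ih j (by omega) (by omega)) ?_
      have h : k ≤ 5 := by omega
      interval_cases k
      · exact areaTree_equation_one
      · exact areaTree_equation_two
      · exact areaTree_equation_three
      · exact areaTree_equation_four
      · exact areaTree_equation_five
      · exact areaTree_equation_six

/-- The iterated images of `1` under `treeEuler`. -/
noncomputable def eulerPowOne : ℕ → ℝ[X]
  | 0 => 1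
  | 1 => X
  | 2 => X * (1 + 3 * X + X ^ 2)
  | 3 => X * (1 + 9 * X + 19 * X ^ 2 + 13 * X ^ 3 + 3 * X ^ 4)
  | 4 => X * (1 + 21 * X + 103 * X ^ 2 + 203 * X ^ 3 + 189 * X ^ 4 + 85 * X ^ 5 +
      15 * X ^ 6)
  | 5 => X * (1 + 45 * X + 415 * X ^ 2 + 1575 * X ^ 3 + 3081 * X ^ 4 + 3401 * X ^ 5 +
      2155 * X ^ 6 + 735 * X ^ 7 + 105 * X ^ 8)
  | 6 => X * (1 + 93 * X + 1471 * X ^ 2 + 9295 * X ^ 3 + 30825 * X ^ 4 + 60597 * X ^ 5 +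
      74703 * X ^ 6 + 58611 * X ^ 7 + 28525 * X ^ 8 + 7875 * X ^ 9 + 945 * X ^ 10)
  | 7 => X * (1 + 189 * X + 4879 * X ^ 2 + 47663 * X ^ 3 + 242193 * X ^ 4 + 739837 * X ^ 5
      + 1464807 * X ^ 6 + 1953015 * X ^ 7 + 1776033 * X ^ 8 + 1089613 * X ^ 9 + 432495 * X ^ 10 +
      100485 * X ^ 11 + 10395 * X ^ 12)
  | 8 => X * (1 + 381 * X + 15583 * X ^ 2 + 225183 * X ^ 3 + 1654569 * X ^ 4 +
      7293797 * X ^ 5 + 21082495 * X ^ 6 + 42035247 * X ^ 7 + 59439201 * X ^ 8 + 60264877 * X ^ 9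
      + 43623615 * X ^ 10 + 22049335 * X ^ 11 + 7404705 * X ^ 12 + 1486485 * X ^ 13 +
      135135 * X ^ 14)
  | 9 => X * (1 + 765 * X + 48655 * X ^ 2 + 1010575 * X ^ 3 + 10346241 * X ^ 4 +
      62863773 * X ^ 5 + 250669671 * X ^ 6 + 696282183 * X ^ 7 + 1397129473 * X ^ 8 +
      2068275565 * X ^ 9 + 2280374991 * X ^ 10 + 1870583935 * X ^ 11 + 1127354305 * X ^ 12 +
      485329845 * X ^ 13 + 141396255 * X ^ 14 + 24999975 * X ^ 15 + 2027025 * X ^ 16)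
  | _ => 0

theorem coeff_treeSeries_eulerPowOne {j : ℕ} (hj : j ≤ 9) (n : ℕ) :
    PowerSeries.coeff n (treeSeries (eulerPowOne j)) =
      (n : ℝ) ^ j * PowerSeries.coeff n (treeSeries (1)) := by
  induction j with
  | zero => rw [pow_zero, one_mul, eulerPowOne]
  | succ j ih =>
    have h : eulerPowOne (j + 1) = treeEuler (eulerPowOne j) := by
      have h : j ≤ 8 := by omega
      refine Polynomial.funext fun x => ?_
      interval_cases j <;> simp [eulerPowOne, treeEuler, derivative_pow] <;> ring
    rw [h, coeff_treeSeries_treeEuler, ih (by omega)]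
    ring

/-- The iterated images of `X ^ 2` under `treeEuler`. -/
noncomputable def eulerPowSq : ℕ → ℝ[X]
  | 0 => X ^ 2
  | 1 => X ^ 2 * (2 + 5 * X + 2 * X ^ 2)
  | 2 => X ^ 2 * (4 + 25 * X + 47 * X ^ 2 + 33 * X ^ 3 + 8 * X ^ 4)
  | 3 => X ^ 2 * (8 + 95 * X + 371 * X ^ 2 + 663 * X ^ 3 + 599 * X ^ 4 + 269 * X ^ 5 +
      48 * X ^ 6)
  | 4 => X ^ 2 * (16 + 325 * X + 2165 * X ^ 2 + 6939 * X ^ 3 + 12371 * X ^ 4 +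
      12985 * X ^ 5 + 8013 * X ^ 6 + 2699 * X ^ 7 + 384 * X ^ 8)
  | 5 => X ^ 2 * (32 + 1055 * X + 10967 * X ^ 2 + 55155 * X ^ 3 + 159215 * X ^ 4 +
      286413 * X ^ 5 + 333105 * X ^ 6 + 251407 * X ^ 7 + 119225 * X ^ 8 + 32355 * X ^ 9 +
      3840 * X ^ 10)
  | 6 => X ^ 2 * (64 + 3325 * X + 51317 * X ^ 2 + 377643 * X ^ 3 + 1605863 * X ^ 4 +
      4350461 * X ^ 5 + 7916325 * X ^ 6 + 9930339 * X ^ 7 + 8633823 * X ^ 8 + 5122293 * X ^ 9 +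
      1982495 * X ^ 10 + 451905 * X ^ 11 + 46080 * X ^ 12)
  | 7 => X ^ 2 * (128 + 10295 * X + 228671 * X ^ 2 + 2360043 * X ^ 3 + 13994519 * X ^ 4 +
      53217661 * X ^ 5 + 138222693 * X ^ 6 + 254403803 * X ^ 7 + 338345271 * X ^ 8 +
      327028557 * X ^ 9 + 227940909 * X ^ 10 + 111782363 * X ^ 11 + 36636495 * X ^ 12 +
      7211085 * X ^ 13 + 645120 * X ^ 14)
  | _ => 0

theorem coeff_treeSeries_eulerPowSq {j : ℕ} (hj : j ≤ 7) (n : ℕ) :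
    PowerSeries.coeff n (treeSeries (eulerPowSq j)) =
      (n : ℝ) ^ j * PowerSeries.coeff n (treeSeries (X ^ 2)) := by
  induction j with
  | zero => rw [pow_zero, one_mul, eulerPowSq]
  | succ j ih =>
    have h : eulerPowSq (j + 1) = treeEuler (eulerPowSq j) := by
      have h : j ≤ 6 := by omega
      refine Polynomial.funext fun x => ?_
      interval_cases j <;> simp [eulerPowSq, treeEuler, derivative_pow] <;> ring
    rw [h, coeff_treeSeries_treeEuler, ih (by omega)]
    ring

theorem coeff_treeSeries_add (p q : ℝ[X]) (n : ℕ) :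
    PowerSeries.coeff n (treeSeries (p + q)) =
      PowerSeries.coeff n (treeSeries p) + PowerSeries.coeff n (treeSeries q) := by
  rw [treeSeries_add, map_add]

/-- Expansion in the basis of `treeEuler`-iterates, as in the next four lemmas. The factor on the
left is `k!`; the coefficients of `eulerPowOne` are those of `A_k`, and the coefficients of
`eulerPowSq` are half those of `B_k`, because `areaCoeff 1` is half the coefficient of `treeSeries
(X ^ 2)`. -/
theorem areaTree_two_eq : C 2 * areaTree 2 = C (-1/3) * eulerPowOne 1 + C
    (-1/12) * eulerPowOne 2 + C (5/12) * eulerPowOne 3 + C (-7/6) * eulerPowSq 0 + C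
    (-7/6) * eulerPowSq 1 := by
  refine Polynomial.funext fun x => ?_
  simp [areaTree, eulerPowOne, eulerPowSq]
  ring

theorem areaTree_three_eq : C 6 * areaTree 3 = C (259/192) * eulerPowOne 1 + C
    (199/192) * eulerPowOne 2 + C (-283/192) * eulerPowOne 3 + C (-175/192) * eulerPowOne 4 + C
    (743/192) * eulerPowSq 0 + C (1219/192) * eulerPowSq 1 + C (521/192) * eulerPowSq 2 + C
    (15/64) * eulerPowSq 3 := by
  refine Polynomial.funext fun x => ?_
  simp [areaTree, eulerPowOne, eulerPowSq]
  ring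

theorem areaTree_four_eq : C 24 * areaTree 4 = C (-187463/30240) * eulerPowOne 1 + C
    (-1375/189) * eulerPowOne 2 + C (22217/5040) * eulerPowOne 3 + C (101897/15120) * eulerPowOne
    4 + C (63737/30240) * eulerPowOne 5 + C (221/1008) * eulerPowOne 6 + C
    (-503803/30240) * eulerPowSq 0 + C (-7409/210) * eulerPowSq 1 + C (-130243/5040) * eulerPowSq
    2 + C (-449/54) * eulerPowSq 3 + C (-35/32) * eulerPowSq 4 := by
  refine Polynomial.funext fun x => ?_
  simp [areaTree, eulerPowOne, eulerPowSq]
  ring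

theorem areaTree_five_eq : C 120 * areaTree 5 = C (392763901/11612160) * eulerPowOne 1 + C
    (24676991/483840) * eulerPowOne 2 + C (-94846903/11612160) * eulerPowOne 3 + C
    (-30773609/725760) * eulerPowOne 4 + C (-99955651/3870720) * eulerPowOne 5 + C
    (-2170159/290304) * eulerPowOne 6 + C (-105845/110592) * eulerPowOne 7 + C
    (1024580441/11612160) * eulerPowSq 0 + C (159943787/725760) * eulerPowSq 1 + C
    (826358527/3870720) * eulerPowSq 2 + C (1111349/10368) * eulerPowSq 3 + C
    (9832585/331776) * eulerPowSq 4 + C (1005/256) * eulerPowSq 5 + C (565/4096) * eulerPowSq 6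
    := by
  refine Polynomial.funext fun x => ?_
  simp [areaTree, eulerPowOne, eulerPowSq]
  ring

theorem areaTree_six_eq : C 720 * areaTree 6 = C (-358936540409/1660538880) * eulerPowOne 1 +
    C (-643359542029/1660538880) * eulerPowOne 2 + C (-18783816473/332107776) * eulerPowOne 3 + C
    (88215445651/332107776) * eulerPowOne 4 + C (414139396709/1660538880) * eulerPowOne 5 + C
    (14473244813/127733760) * eulerPowOne 6 + C (9401544029/332107776) * eulerPowOne 7 + C
    (373340075/110702592) * eulerPowOne 8 + C (82825/576576) * eulerPowOne 9 + C
    (-921390308389/1660538880) * eulerPowSq 0 + C (-864000570107/553512960) * eulerPowSq 1 + C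
    (-601794266581/332107776) * eulerPowSq 2 + C (-149860633081/127733760) * eulerPowSq 3 + C
    (-119912501/258048) * eulerPowSq 4 + C (-259283273/2322432) * eulerPowSq 5 + C
    (-186349/12288) * eulerPowSq 6 + C (-3955/4096) * eulerPowSq 7 := by
  refine Polynomial.funext fun x => ?_
  simp [areaTree, eulerPowOne, eulerPowSq]
  ring

theorem areaCoeff_one (n : ℕ) :
    areaCoeff 1 n = 1 / 2 * PowerSeries.coeff n (treeSeries (X ^ 2)) := by
  rw [← coeff_momentSeries, momentSeries_eq_treeSeries (by norm_num), areaTree,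
    coeff_treeSeries_C_mul]

theorem coeff_treeSeries_one (n : ℕ) : PowerSeries.coeff n (treeSeries 1) = areaCoeff 0 n := by
  rw [treeSeries, map_one, mul_one, coeff_momentSeries]

theorem areaCoeff_zero_pos (n : ℕ) : 0 < areaCoeff 0 n := by
  rw [areaCoeff_zero_left]; positivity

theorem factorialMoment_eq_areaCoeff (k n : ℕ) :
    factorialMoment k n = k.factorial * areaCoeff k n / areaCoeff 0 n := by
  rw [factorialMoment_eq, areaCoeff, areaCoeff, ← mul_div_assoc,
    div_div_div_cancel_right₀ (by positivity)]

theorem E₁_eq_div (n : ℕ) : E₁ n = areaCoeff 1 n / areaCoeff 0 n := by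
  rw [E₁_eq_factorialMoment, factorialMoment_eq_areaCoeff, Nat.factorial_one, Nat.cast_one, one_mul]

theorem factorialMoment_eq_of_polynomial {k : ℕ} (n : ℕ) (a b : ℝ) (hk : k ≤ 6)
    (h : (k.factorial : ℝ) * PowerSeries.coeff n (treeSeries (areaTree k)) =
      a * areaCoeff 0 n + b * areaCoeff 1 n) :
    factorialMoment k n = a + b * E₁ n := by
  rw [factorialMoment_eq_areaCoeff, E₁_eq_div, ← coeff_momentSeries k,
    momentSeries_eq_treeSeries hk, h]
  have := (areaCoeff_zero_pos n).ne'
  field_simp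

theorem E₁_formula (n : ℕ) : E₁ n =
    -(n : ℝ) / 2 + 1 / 2 * (((n + 1).factorial : ℝ) / ((n : ℝ) + 1) ^ n)
      * ∑ k ∈ Finset.range n, ((n : ℝ) + 1) ^ k / (k.factorial : ℝ) := by
  rw [E₁_eq_div, areaCoeff_one, coeff_treeSeries_X_sq, areaCoeff_zero_left, Finset.sum_range_succ,
    Nat.factorial_succ]
  -- The exponent `n - 1` is truncated at `n = 0`, so that case is separate.
  rcases n with _ | n
  · simp; norm_num
  · have h1 : ((n + 1).factorial : ℝ) ≠ 0 := by positivity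
    have h2 : ((n : ℝ) + 1 + 1) ≠ 0 := by positivity
    rw [Nat.add_sub_cancel]
    push_cast
    field_simp
    ring

theorem factorialMoment_two (n : ℕ) : factorialMoment 2 n = (5 / 12 * (n : ℝ) ^ 3 - 1 /
    12 * (n : ℝ) ^ 2 - 1 / 3 * (n : ℝ)) + (-(7 / 3) * ((n : ℝ) + 1)) * E₁ n := by
  refine factorialMoment_eq_of_polynomial n _ _ (by norm_num) ?_
  have h := congrArg (fun p => PowerSeries.coeff n (treeSeries p)) areaTree_two_eq
  simp only [coeff_treeSeries_add, coeff_treeSeries_C_mul] at h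
  simp only [Nat.factorial, areaCoeff_one, ← coeff_treeSeries_one]
  push_cast
  norm_num only at h ⊢
  rw [h]
  simp (disch := norm_num) only [coeff_treeSeries_eulerPowOne, coeff_treeSeries_eulerPowSq]
  ring

theorem factorialMoment_three (n : ℕ) : factorialMoment 3 n = (-(175 / 192) * (n : ℝ) ^ 4
    - 283 / 192 * (n : ℝ) ^ 3 + 199 / 192 * (n : ℝ) ^ 2 + 259 / 192 * (n : ℝ)) + (15 / 32 * (n :
    ℝ) ^ 3 + 521 / 96 * (n : ℝ) ^ 2 + 1219 / 96 * (n : ℝ) + 743 / 96) * E₁ n := by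
  refine factorialMoment_eq_of_polynomial n _ _ (by norm_num) ?_
  have h := congrArg (fun p => PowerSeries.coeff n (treeSeries p)) areaTree_three_eq
  simp only [coeff_treeSeries_add, coeff_treeSeries_C_mul] at h
  simp only [Nat.factorial, areaCoeff_one, ← coeff_treeSeries_one]
  push_cast
  norm_num only at h ⊢
  rw [h]
  simp (disch := norm_num) only [coeff_treeSeries_eulerPowOne, coeff_treeSeries_eulerPowSq]
  ring

theorem factorialMoment_four (n : ℕ) : factorialMoment 4 n = (221 / 1008 * (n : ℝ) ^ 6 +
    63737 / 30240 * (n : ℝ) ^ 5 + 101897 / 15120 * (n : ℝ) ^ 4 + 22217 / 5040 * (n : ℝ) ^ 3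
    - 1375 / 189 * (n : ℝ) ^ 2 - 187463 / 30240 * (n : ℝ)) + (-(35 / 16) * (n : ℝ) ^ 4 - 449 /
    27 * (n : ℝ) ^ 3 - 130243 / 2520 * (n : ℝ) ^ 2 - 7409 / 105 * (n : ℝ) - 503803 / 15120) * E₁
    n := by
  refine factorialMoment_eq_of_polynomial n _ _ (by norm_num) ?_
  have h := congrArg (fun p => PowerSeries.coeff n (treeSeries p)) areaTree_four_eq
  simp only [coeff_treeSeries_add, coeff_treeSeries_C_mul] at h
  simp only [Nat.factorial, areaCoeff_one, ← coeff_treeSeries_one]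
  push_cast
  norm_num only at h ⊢
  rw [h]
  simp (disch := norm_num) only [coeff_treeSeries_eulerPowOne, coeff_treeSeries_eulerPowSq]
  ring

theorem factorialMoment_five (n : ℕ) : factorialMoment 5 n = (-(105845 / 110592) * (n :
    ℝ) ^ 7 - 2170159 / 290304 * (n : ℝ) ^ 6 - 99955651 / 3870720 * (n : ℝ) ^ 5 - 30773609 /
    725760 * (n : ℝ) ^ 4 - 94846903 / 11612160 * (n : ℝ) ^ 3 + 24676991 / 483840 * (n : ℝ) ^ 2 +
    392763901 / 11612160 * (n : ℝ)) + (565 / 2048 * (n : ℝ) ^ 6 + 1005 / 128 * (n : ℝ) ^ 5 +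
    9832585 / 165888 * (n : ℝ) ^ 4 + 1111349 / 5184 * (n : ℝ) ^ 3 + 826358527 / 1935360 * (n :
    ℝ) ^ 2 + 159943787 / 362880 * (n : ℝ) + 1024580441 / 5806080) * E₁ n := by
  refine factorialMoment_eq_of_polynomial n _ _ (by norm_num) ?_
  have h := congrArg (fun p => PowerSeries.coeff n (treeSeries p)) areaTree_five_eq
  simp only [coeff_treeSeries_add, coeff_treeSeries_C_mul] at h
  simp only [Nat.factorial, areaCoeff_one, ← coeff_treeSeries_one]
  push_cast
  norm_num only at h ⊢
  rw [h]
  simp (disch := norm_num) only [coeff_treeSeries_eulerPowOne, coeff_treeSeries_eulerPowSq]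
  ring

theorem factorialMoment_six (n : ℕ) : factorialMoment 6 n = (82825 / 576576 * (n : ℝ) ^ 9 +
    373340075 / 110702592 * (n : ℝ) ^ 8 + 9401544029 / 332107776 * (n : ℝ) ^ 7 + 14473244813 /
    127733760 * (n : ℝ) ^ 6 + 414139396709 / 1660538880 * (n : ℝ) ^ 5 + 88215445651 /
    332107776 * (n : ℝ) ^ 4 - 18783816473 / 332107776 * (n : ℝ) ^ 3 - 643359542029 /
    1660538880 * (n : ℝ) ^ 2 - 358936540409 / 1660538880 * (n : ℝ)) + (-(3955 / 2048) * (n :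
    ℝ) ^ 7 - 186349 / 6144 * (n : ℝ) ^ 6 - 259283273 / 1161216 * (n : ℝ) ^ 5 - 119912501 /
    129024 * (n : ℝ) ^ 4 - 149860633081 / 63866880 * (n : ℝ) ^ 3 - 601794266581 / 166053888 * (n
    : ℝ) ^ 2 - 864000570107 / 276756480 * (n : ℝ) - 921390308389 / 830269440) * E₁ n := by
  refine factorialMoment_eq_of_polynomial n _ _ (by norm_num) ?_
  have h := congrArg (fun p => PowerSeries.coeff n (treeSeries p)) areaTree_six_eq
  simp only [coeff_treeSeries_add, coeff_treeSeries_C_mul] at h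
  simp only [Nat.factorial, areaCoeff_one, ← coeff_treeSeries_one]
  push_cast
  norm_num only at h ⊢
  rw [h]
  simp (disch := norm_num) only [coeff_treeSeries_eulerPowOne, coeff_treeSeries_eulerPowSq]
  ring

end ExplicitPolynomials

/-! ### Two-sided bounds for Ramanujan's function -/

section Ramanujan

/-- Ramanujan's function `Q(N) = N! / N ^ N * ∑_{k < N} N ^ k / k!`. -/
noncomputable def ramanujanQ (N : ℕ) : ℝ :=
  (N.factorial : ℝ) / (N : ℝ) ^ N * ∑ k ∈ Finset.range N, (N : ℝ) ^ k / k.factorial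

/-- Terms of the exponential series at `N` are paired by reflection about the equal terms of index
`N - 1` and `N`. -/
theorem pow_div_factorial_le (N j : ℕ) (hj : j < N) :
    (N : ℝ) ^ (N - 1 - j) / ((N - 1 - j).factorial : ℝ) ≤
      (N : ℝ) ^ (N + j) / ((N + j).factorial : ℝ) := by
  rw [div_le_div_iff₀ (by positivity) (by positivity)]
  induction j with
  | zero =>
    obtain ⟨M, rfl⟩ := Nat.exists_eq_succ_of_ne_zero (show N ≠ 0 by omega)
    simp only [Nat.succ_eq_add_one, Nat.add_sub_cancel, Nat.sub_zero, add_zero]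
    rw [Nat.factorial_succ]
    push_cast
    exact le_of_eq (by ring)
  | succ j ih =>
    have h := ih (by omega)
    obtain ⟨d, rfl⟩ := Nat.exists_eq_add_of_lt hj
    rw [show j + 1 + d + 1 - 1 - j = d + 1 by omega] at h
    rw [show j + 1 + d + 1 - 1 - (j + 1) = d by omega]
    rw [Nat.factorial_succ d, pow_succ] at h
    rw [← add_assoc _ j 1, Nat.factorial_succ (_ + j), pow_succ _ (_ + j)]
    set N := j + 1 + d + 1 with hN
    have hN0 : (0 : ℝ) < N := by positivity
    -- Here `d + 1 = N - (j + 1)`, so the product is `N ^ 2 - (j + 1) ^ 2`.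
    have h1 : ((N : ℝ) + j + 1) * (d + 1) ≤ N * N := by
      have : (N : ℝ) = j + 1 + d + 1 := by rw [hN]; push_cast; ring
      rw [this]
      nlinarith [sq_nonneg ((j : ℝ) + 1)]
    push_cast at h ⊢
    have h2 : 0 ≤ (N : ℝ) ^ d * ((N + j).factorial : ℝ) := by positivity
    have h3 : 0 ≤ (N : ℝ) ^ (N + j) * (d.factorial : ℝ) := by positivity
    refine le_of_mul_le_mul_right ?_ hN0
    calc (N : ℝ) ^ d * (((N : ℝ) + j + 1) * ((N + j).factorial : ℝ)) * N
        = ((N : ℝ) + j + 1) * ((N : ℝ) ^ d * N * ((N + j).factorial : ℝ)) := by ring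
      _ ≤ ((N : ℝ) + j + 1) * ((N : ℝ) ^ (N + j) * ((d + 1) * (d.factorial : ℝ))) := by
          gcongr
      _ = ((N : ℝ) ^ (N + j) * (d.factorial : ℝ)) * (((N : ℝ) + j + 1) * (d + 1)) := by ring
      _ ≤ ((N : ℝ) ^ (N + j) * (d.factorial : ℝ)) * (N * N) := by gcongr
      _ = _ := by ring

theorem two_mul_sum_le_exp (N : ℕ) :
    2 * ∑ k ∈ Finset.range N, (N : ℝ) ^ k / (k.factorial : ℝ) ≤ Real.exp N := by
  refine le_trans ?_ (Real.sum_le_exp_of_nonneg (Nat.cast_nonneg N) (N + N))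
  rw [Finset.sum_range_add, two_mul]
  refine add_le_add le_rfl ?_
  rw [← Finset.sum_range_reflect]
  exact Finset.sum_le_sum fun j hj => pow_div_factorial_le N j (Finset.mem_range.1 hj)

/-- Subtracting `1 / (2 * (n + 1))` from the logarithm gives an increasing sequence with limit `log
√π`. The constant 2 is far from sharp, but an error factor `1 + O(1 / n)` is all that is needed. -/
theorem stirlingSeq_succ_le (n : ℕ) :
    Stirling.stirlingSeq (n + 1) ≤ √Real.pi * Real.exp (1 / (2 * ((n : ℝ) + 1))) := by
  have hmono : Monotone fun n : ℕ =>
      Real.log (Stirling.stirlingSeq (n + 1)) - 1 / (2 * ((n : ℝ) + 1)) := by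
    refine monotone_nat_of_le_succ fun m => ?_
    have h := Stirling.log_stirlingSeq_sdiff_le (m + 1)
    have h2 : 1 / (12 * ((m : ℝ) + 1) * ((m : ℝ) + 1 + 1)) ≤
        1 / (2 * ((m : ℝ) + 1)) - 1 / (2 * ((m : ℝ) + 1 + 1)) := by
      rw [div_sub_div _ _ (by positivity) (by positivity),
        div_le_div_iff₀ (by positivity) (by positivity)]
      have : 0 ≤ ((m : ℝ) + 1) * ((m : ℝ) + 1 + 1) := by positivity
      nlinarith
    push_cast at h ⊢
    linarith
  have hlim : Tendsto (fun n : ℕ =>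
      Real.log (Stirling.stirlingSeq (n + 1)) - 1 / (2 * ((n : ℝ) + 1))) atTop
      (nhds (Real.log √Real.pi - 0)) := by
    refine Tendsto.sub ?_ ?_
    · exact (Real.continuousAt_log (by positivity)).tendsto.comp
        (Stirling.tendsto_stirlingSeq_sqrt_pi.comp (tendsto_add_atTop_nat 1))
    · have h := (tendsto_one_div_add_atTop_nhds_zero_nat (𝕜 := ℝ)).const_mul (1 / 2)
      rw [mul_zero] at h
      refine h.congr fun n => ?_
      field_simp
  have h := hmono.ge_of_tendsto hlim n
  simp only [sub_zero] at h
  rw [← Real.log_le_log_iff (Stirling.stirlingSeq'_pos n) (by positivity),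
    Real.log_mul (by positivity) (by positivity), Real.log_exp]
  linarith

/-- The sum in `Q` is at most half of `exp N`, so `Q(N)` is at most `√(2N) / 2` times the Stirling
sequence. The relative error `1 / N` costs at most an additive 2. -/
theorem ramanujanQ_le {N : ℕ} (hN : N ≠ 0) : ramanujanQ N ≤ √(Real.pi * N / 2) + 2 := by
  obtain ⟨n, rfl⟩ := Nat.exists_eq_succ_of_ne_zero hN
  set N := n.succ with hNdef
  have hN0 : (0 : ℝ) < N := by positivity
  have hN1 : (1 : ℝ) ≤ N := by exact_mod_cast Nat.succ_le_succ (Nat.zero_le n)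
  have hcast : ((n : ℝ) + 1) = N := by rw [hNdef]; push_cast; ring
  have h1 : ramanujanQ N ≤ Stirling.stirlingSeq N * √(2 * N) / 2 := by
    have h2 := two_mul_sum_le_exp N
    have h3 : Stirling.stirlingSeq N * √(2 * N) =
        (N.factorial : ℝ) / (N : ℝ) ^ N * Real.exp N := by
      rw [Stirling.stirlingSeq, div_pow, ← Real.exp_nat_mul, mul_one]
      have : √(2 * (N : ℝ)) ≠ 0 := by positivity
      field_simp
    rw [h3, ramanujanQ, mul_div_assoc]
    gcongr
    linarith
  have h2 := stirlingSeq_succ_le n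
  rw [hcast] at h2
  have h3 : Real.exp (1 / (2 * (N : ℝ))) ≤ 1 + 1 / N := by
    have hx : |1 / (2 * (N : ℝ))| ≤ 1 := by
      rw [abs_of_nonneg (by positivity), div_le_one (by positivity)]
      linarith
    have := Real.abs_exp_sub_one_le hx
    rw [abs_of_nonneg (by positivity : 0 ≤ 1 / (2 * (N : ℝ)))] at this
    have h4 := (abs_le.1 this).2
    have h5 : 2 * (1 / (2 * (N : ℝ))) = 1 / N := by field_simp
    linarith
  have h4 : √Real.pi * √(2 * N) / 2 = √(Real.pi * N / 2) := by
    rw [← Real.sqrt_mul Real.pi_pos.le, div_eq_iff two_ne_zero]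
    rw [show Real.pi * (2 * N) = (Real.pi * N / 2) * 2 ^ 2 by ring,
      Real.sqrt_mul (by positivity), Real.sqrt_sq two_pos.le]
  have h5 : √(Real.pi * N / 2) ≤ 2 * N := by
    rw [Real.sqrt_le_left (by positivity)]
    nlinarith [Real.pi_le_four]
  calc ramanujanQ N ≤ Stirling.stirlingSeq N * √(2 * N) / 2 := h1
    _ ≤ √Real.pi * (1 + 1 / N) * √(2 * N) / 2 := by
        gcongr
        exact h2.trans (by gcongr)
    _ = √(Real.pi * N / 2) + √(Real.pi * N / 2) / N := by rw [← h4]; field_simp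
    _ ≤ √(Real.pi * N / 2) + 2 := by
        gcongr
        rwa [div_le_iff₀ hN0]

theorem integrableOn_pow_mul_exp_neg (k : ℕ) :
    MeasureTheory.IntegrableOn (fun t : ℝ => t ^ k * Real.exp (-t)) (Set.Ioi 0) := by
  have h := Real.GammaIntegral_convergent (s := (k : ℝ) + 1) (by positivity)
  refine h.congr_fun (fun t _ => ?_) measurableSet_Ioi
  simp [mul_comm]

theorem integral_pow_mul_exp_neg (k : ℕ) :
    ∫ t in Set.Ioi (0 : ℝ), t ^ k * Real.exp (-t) = k.factorial := by
  rw [← Real.Gamma_nat_eq_factorial, Real.Gamma_eq_integral (by positivity)]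
  refine MeasureTheory.setIntegral_congr_fun measurableSet_Ioi fun t _ => ?_
  simp [mul_comm]

theorem one_add_div_pow_mul_exp (N : ℕ) (t : ℝ) : (1 + t / N) ^ N * Real.exp (-t) =
    ∑ k ∈ Finset.range (N + 1), (N.choose k : ℝ) / (N : ℝ) ^ k * (t ^ k * Real.exp (-t)) := by
  rw [add_comm, add_pow, Finset.sum_mul]
  refine Finset.sum_congr rfl fun k _ => ?_
  rw [div_pow, one_pow]
  ring

/-- Expanding binomially and integrating termwise gives the terms `N! / ((N - k)! * N ^ k)`, which
are those of `Q` in reverse order plus the top term, equal to 1. -/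
theorem integral_one_add_div_pow {N : ℕ} (hN : N ≠ 0) :
    ∫ t in Set.Ioi (0 : ℝ), (1 + t / N) ^ N * Real.exp (-t) = ramanujanQ N + 1 := by
  simp_rw [one_add_div_pow_mul_exp]
  rw [MeasureTheory.integral_finsetSum _ fun k _ =>
    (integrableOn_pow_mul_exp_neg k).const_mul _]
  simp_rw [MeasureTheory.integral_const_mul, integral_pow_mul_exp_neg]
  have hN0 : (N : ℝ) ≠ 0 := Nat.cast_ne_zero.2 hN
  have h1 : ramanujanQ N + 1 = (N.factorial : ℝ) / (N : ℝ) ^ N *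
      ∑ k ∈ Finset.range (N + 1), (N : ℝ) ^ k / k.factorial := by
    rw [Finset.sum_range_succ, mul_add, ← ramanujanQ]
    field_simp
  rw [h1, ← Finset.sum_range_reflect, Finset.mul_sum]
  refine Finset.sum_congr rfl fun k hk => ?_
  have hk' := Nat.lt_succ_iff.1 (Finset.mem_range.1 hk)
  rw [Nat.add_sub_cancel, Nat.cast_choose ℝ (Nat.sub_le N k), Nat.sub_sub_self hk']
  have h2 : (N : ℝ) ^ N = (N : ℝ) ^ (N - k) * (N : ℝ) ^ k := by
    rw [← pow_add, Nat.sub_add_cancel hk']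
  rw [h2]
  field_simp

theorem exp_neg_sq_le {N : ℕ} (hN : N ≠ 0) {t : ℝ} (ht : 0 ≤ t) :
    Real.exp (-(1 / (2 * (N : ℝ))) * t ^ 2) ≤ (1 + t / N) ^ N * Real.exp (-t) := by
  have hN0 : (0 : ℝ) < N := by positivity
  have hu : 0 ≤ t / N := by positivity
  have h1 : t / N - (t / N) ^ 2 / 2 ≤ Real.log (1 + t / N) := by
    -- The intermediate bound is `2u / (u + 2) ≤ log (1 + u)`, and `(u - u ^ 2 / 2) * (u + 2) = 2u -
    -- u ^ 3 / 2`.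
    refine le_trans ?_ (Real.le_log_one_add_of_nonneg hu)
    rw [le_div_iff₀ (by positivity)]
    have : 0 ≤ (t / N) ^ 3 := by positivity
    nlinarith
  have h2 : (1 + t / N) ^ N = Real.exp (N * Real.log (1 + t / N)) := by
    rw [Real.exp_nat_mul, Real.exp_log (by positivity)]
  rw [h2, ← Real.exp_add, Real.exp_le_exp]
  have h3 := mul_le_mul_of_nonneg_left h1 hN0.le
  have h4 : (N : ℝ) * (t / N - (t / N) ^ 2 / 2) = t - 1 / (2 * (N : ℝ)) * t ^ 2 := by
    field_simp
  linarith

/-- The integrand representing `Q(N) + 1` dominates the Gaussian `exp (-t ^ 2 / (2N))`, whose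
integral over the half-line is `√(πN/2)`. -/
theorem le_ramanujanQ {N : ℕ} (hN : N ≠ 0) : √(Real.pi * N / 2) - 1 ≤ ramanujanQ N := by
  have hN0 : (0 : ℝ) < N := by positivity
  rw [sub_le_iff_le_add, ← integral_one_add_div_pow hN]
  have h1 := integral_gaussian_Ioi (1 / (2 * (N : ℝ)))
  have h2 : √(Real.pi / (1 / (2 * (N : ℝ)))) / 2 = √(Real.pi * N / 2) := by
    rw [div_eq_iff two_ne_zero,
      show Real.pi / (1 / (2 * (N : ℝ))) = (Real.pi * N / 2) * 2 ^ 2 by field_simp,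
      Real.sqrt_mul (by positivity), Real.sqrt_sq two_pos.le]
  rw [← h2, ← h1]
  refine MeasureTheory.setIntegral_mono_on (integrable_exp_neg_mul_sq (by positivity)).integrableOn
    ?_ measurableSet_Ioi fun t ht => exp_neg_sq_le hN (le_of_lt ht)
  simp_rw [one_add_div_pow_mul_exp]
  exact MeasureTheory.integrable_finsetSum _ fun k _ =>
    (integrableOn_pow_mul_exp_neg k).const_mul _

end Ramanujan

theorem E₁_eq_ramanujanQ (n : ℕ) :
    E₁ n = -(n : ℝ) / 2 + 1 / 2 * ((n : ℝ) + 1) * (ramanujanQ (n + 1) - 1) := by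
  rw [E₁_formula, ramanujanQ, Finset.sum_range_succ, Nat.factorial_succ]
  push_cast
  field_simp
  ring

/-- The `O(1)` error in `Q(n + 1)` is multiplied by `(n + 1) / 2`, and replacing `(n + 1) ^ (3/2)`
by `n ^ (3/2)` also costs `O(n)`; the constant 10 leaves room for both and for the linear terms. -/
theorem E₁_sub_isBigO :
    (fun n : ℕ => E₁ n - √(2 * Real.pi) / 4 * (n : ℝ) ^ (3 / 2 : ℝ)) =O[atTop]
      fun n : ℕ => (n : ℝ) := by
  refine IsBigO.of_bound 10 ?_
  filter_upwards [eventually_ge_atTop 1] with n hn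
  have hn1 : (1 : ℝ) ≤ n := by exact_mod_cast hn
  have hl := le_ramanujanQ n.succ_ne_zero
  have hu := ramanujanQ_le n.succ_ne_zero
  have hs : √(Real.pi * ((n + 1 : ℕ) : ℝ) / 2) = √(2 * Real.pi) / 2 * √((n : ℝ) + 1) := by
    rw [div_mul_eq_mul_div, ← Real.sqrt_mul (by positivity), eq_div_iff two_ne_zero,
      show 2 * Real.pi * ((n : ℝ) + 1) = (Real.pi * ((n + 1 : ℕ) : ℝ) / 2) * 2 ^ 2 by
        push_cast; ring,
      Real.sqrt_mul (by positivity), Real.sqrt_sq two_pos.le]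
  rw [Nat.succ_eq_add_one, hs] at hl hu
  have hp : (n : ℝ) ^ (3 / 2 : ℝ) = n * √n := by
    rw [show (3 / 2 : ℝ) = 1 + 1 / 2 by norm_num, Real.rpow_add (by positivity), Real.rpow_one,
      Real.sqrt_eq_rpow]
  have hc : √(2 * Real.pi) ≤ 3 := by
    rw [Real.sqrt_le_left (by norm_num)]
    nlinarith [Real.pi_le_four]
  have hc0 : 0 ≤ √(2 * Real.pi) := Real.sqrt_nonneg _
  rw [E₁_eq_ramanujanQ, hp, Real.norm_eq_abs, Real.norm_eq_abs, abs_of_nonneg (by positivity :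
    (0 : ℝ) ≤ n)]
  have h1 : √(n : ℝ) ≤ √((n : ℝ) + 1) := Real.sqrt_le_sqrt (by linarith)
  have h2 : √((n : ℝ) + 1) ≤ √(n : ℝ) + 1 := by
    rw [Real.sqrt_le_left (by positivity)]
    nlinarith [Real.sq_sqrt (by positivity : (0 : ℝ) ≤ n), Real.sqrt_nonneg (n : ℝ)]
  have h3 : √(n : ℝ) ≤ n := by
    rw [Real.sqrt_le_left (by positivity)]
    nlinarith
  set c := √(2 * Real.pi)
  set a := √((n : ℝ) + 1)
  set b := √(n : ℝ)
  set q := ramanujanQ (n + 1)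
  -- With `a ≤ b + 1` the left side is at most `n + 1 + b`, and both `1` and `b` are at most `n`.
  have h4 : ((n : ℝ) + 1) * a - n * b ≤ 3 * n := by nlinarith
  have h5 : 0 ≤ ((n : ℝ) + 1) * a - n * b := by nlinarith [Real.sqrt_nonneg (n : ℝ)]
  have h6 : c * (((n : ℝ) + 1) * a - n * b) ≤ 3 * (3 * n) := by
    exact mul_le_mul hc h4 h5 (by norm_num)
  have h7 : 0 ≤ c * (((n : ℝ) + 1) * a - n * b) := by positivity
  have h8 : ((n : ℝ) + 1) * (q - c / 2 * a) ≤ ((n : ℝ) + 1) * 2 := by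
    gcongr; linarith
  have h9 : ((n : ℝ) + 1) * (-1) ≤ ((n : ℝ) + 1) * (q - c / 2 * a) := by
    gcongr; linarith
  rw [abs_le]
  constructor <;> nlinarith

/-! ### Leading terms of the factorial moments -/

section Asymptotics

open Polynomial

theorem isBigO_natCast_rpow {a b : ℝ} (h : a ≤ b) :
    (fun n : ℕ => (n : ℝ) ^ a) =O[atTop] fun n : ℕ => (n : ℝ) ^ b := by
  refine IsBigO.of_bound 1 ?_
  filter_upwards [eventually_ge_atTop 1] with n hn
  have hn1 : (1 : ℝ) ≤ n := by exact_mod_cast hn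
  rw [one_mul, Real.norm_of_nonneg (by positivity), Real.norm_of_nonneg (by positivity)]
  exact Real.rpow_le_rpow_of_exponent_le hn1 h

theorem isBigO_eval {p : ℝ[X]} {d : ℕ} (hp : p.natDegree ≤ d) :
    (fun n : ℕ => p.eval (n : ℝ)) =O[atTop] fun n : ℕ => (n : ℝ) ^ (d : ℝ) := by
  have h : p.degree ≤ (X ^ d : ℝ[X]).degree := by
    rw [degree_X_pow]
    exact degree_le_of_natDegree_le hp
  have h2 := (isBigO_atTop_of_degree_le p (X ^ d) h).comp_tendsto tendsto_natCast_atTop_atTop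
  simpa [Function.comp_def] using h2

theorem isBigO_mul_rpow {f g : ℕ → ℝ} {a b : ℝ} (hf : f =O[atTop] fun n : ℕ => (n : ℝ) ^ a)
    (hg : g =O[atTop] fun n : ℕ => (n : ℝ) ^ b) :
    (fun n => f n * g n) =O[atTop] fun n : ℕ => (n : ℝ) ^ (a + b) := by
  refine (hf.mul hg).congr' EventuallyEq.rfl ?_
  filter_upwards [eventually_ge_atTop 1] with n hn
  have hn1 : (0 : ℝ) < n := by exact_mod_cast hn
  rw [Real.rpow_add hn1]

theorem E₁_isBigO : E₁ =O[atTop] fun n : ℕ => (n : ℝ) ^ (3 / 2 : ℝ) := by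
  have h1 : (fun n : ℕ => (n : ℝ)) =O[atTop] fun n : ℕ => (n : ℝ) ^ (3 / 2 : ℝ) := by
    simpa using isBigO_natCast_rpow (show (1 : ℝ) ≤ 3 / 2 by norm_num)
  have h2 := (E₁_sub_isBigO.trans h1).add
    ((isBigO_refl (fun n : ℕ => (n : ℝ) ^ (3 / 2 : ℝ)) atTop).const_mul_left (√(2 * Real.pi) / 4))
  simpa using h2

/-- Asymptotics of `a + b * E₁` when the leading term comes from `a`. -/
theorem isBigO_of_polynomial_left {f : ℕ → ℝ} {p q : ℝ[X]} {c : ℝ} {d : ℕ} {s t : ℝ}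
    (hf : ∀ n, f n = c * (n : ℝ) ^ s + p.eval (n : ℝ) + q.eval (n : ℝ) * E₁ n)
    (hp : p.natDegree ≤ d + 1) (hq : q.natDegree ≤ d) (ht : (d : ℝ) + 3 / 2 = t) :
    (fun n : ℕ => f n - c * (n : ℝ) ^ s) =O[atTop] fun n : ℕ => (n : ℝ) ^ t := by
  have h1 := (isBigO_eval hp).trans (isBigO_natCast_rpow (b := t) (by push_cast; linarith))
  have h2 := isBigO_mul_rpow (isBigO_eval hq) E₁_isBigO
  rw [ht] at h2
  refine (h1.add h2).congr_left fun n => ?_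
  rw [hf]
  ring

/-- Asymptotics of `a + b * E₁` when the leading term comes from `b * E₁`. -/
theorem isBigO_of_polynomial_right {f : ℕ → ℝ} {p q : ℝ[X]} {c : ℝ} {d : ℕ} {s t : ℝ}
    (hf : ∀ n, f n = p.eval (n : ℝ) + (c * (n : ℝ) ^ d + q.eval (n : ℝ)) * E₁ n)
    (hp : p.natDegree ≤ d + 1) (hq : q.natDegree + 1 ≤ d ∨ q = 0) (hs : (d : ℝ) + 3 / 2 = s)
    (ht : (d : ℝ) + 1 = t) :
    (fun n : ℕ => f n - c * (√(2 * Real.pi) / 4) * (n : ℝ) ^ s) =O[atTop]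
      fun n : ℕ => (n : ℝ) ^ t := by
  have h1 := isBigO_eval hp
  have h2 : (fun n : ℕ => q.eval (n : ℝ) * E₁ n) =O[atTop] fun n : ℕ => (n : ℝ) ^ t := by
    rcases hq with hq | rfl
    · obtain ⟨e, rfl⟩ := Nat.exists_eq_add_of_le' (le_of_add_le_right hq)
      have hq' : q.natDegree ≤ e := by omega
      refine (isBigO_mul_rpow (isBigO_eval hq') E₁_isBigO).trans (isBigO_natCast_rpow ?_)
      push_cast at ht
      linarith
    · simpa using isBigO_zero _ _
  have h3 : (fun n : ℕ => (n : ℝ) ^ (d : ℝ) * (E₁ n - √(2 * Real.pi) / 4 *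
      (n : ℝ) ^ (3 / 2 : ℝ))) =O[atTop] fun n : ℕ => (n : ℝ) ^ t := by
    rw [← ht]
    exact isBigO_mul_rpow (isBigO_refl _ _) (by simpa using E₁_sub_isBigO)
  push_cast at h1
  rw [ht] at h1
  refine ((h1.add h2).add (h3.const_mul_left c)).congr' ?_ EventuallyEq.rfl
  filter_upwards [eventually_ge_atTop 1] with n hn
  have hn1 : (0 : ℝ) < n := by exact_mod_cast hn
  rw [hf, ← hs, Real.rpow_add hn1, Real.rpow_natCast]
  ring

theorem factorialMoment_one_isBigO :
    (fun n : ℕ => factorialMoment 1 n - √(2 * Real.pi) / 4 * (n : ℝ) ^ (3 / 2 : ℝ)) =O[atTop]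
      fun n : ℕ => (n : ℝ) ^ (1 : ℝ) := by
  simpa [← E₁_eq_factorialMoment] using E₁_sub_isBigO

theorem factorialMoment_two_isBigO :
    (fun n : ℕ => factorialMoment 2 n - 5 / 12 * (n : ℝ) ^ ((3 : ℕ) : ℝ)) =O[atTop]
      fun n : ℕ => (n : ℝ) ^ (5 / 2 : ℝ) := by
  refine isBigO_of_polynomial_left (d := 1)
    (p := C (-1 / 12) * X ^ 2 + C (-1 / 3) * X)
    (q := C (-7 / 3) * X + C (-7 / 3))
    (fun n => ?_) (by compute_degree) (by compute_degree)
    (by norm_num)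
  rw [factorialMoment_two, Real.rpow_natCast]
  simp only [eval_add, eval_mul, eval_C, eval_pow, eval_X]
  ring

theorem factorialMoment_three_isBigO :
    (fun n : ℕ => factorialMoment 3 n - 15 / 32 * (√(2 * Real.pi) / 4) *
      (n : ℝ) ^ (9 / 2 : ℝ)) =O[atTop] fun n : ℕ => (n : ℝ) ^ (4 : ℝ) := by
  refine isBigO_of_polynomial_right (d := 3)
    (p := C (-175 / 192) * X ^ 4 + C (-283 / 192) * X ^ 3 + C (199 / 192) * X ^ 2 +
      C (259 / 192) * X)
    (q := C (521 / 96) * X ^ 2 + C (1219 / 96) * X + C (743 / 96))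
    (fun n => ?_) (by compute_degree)
    (Or.inl (Nat.succ_le_succ (n := _) (m := 2) (by compute_degree))) (by norm_num) (by norm_num)
  rw [factorialMoment_three]
  simp only [eval_add, eval_mul, eval_C, eval_pow, eval_X]
  ring

theorem factorialMoment_four_isBigO :
    (fun n : ℕ => factorialMoment 4 n - 221 / 1008 * (n : ℝ) ^ ((6 : ℕ) : ℝ)) =O[atTop]
      fun n : ℕ => (n : ℝ) ^ (11 / 2 : ℝ) := by
  refine isBigO_of_polynomial_left (d := 4)
    (p := C (63737 / 30240) * X ^ 5 + C (101897 / 15120) * X ^ 4 + C (22217 / 5040) * X ^ 3 +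
      C (-1375 / 189) * X ^ 2 + C (-187463 / 30240) * X)
    (q := C (-35 / 16) * X ^ 4 + C (-449 / 27) * X ^ 3 + C (-130243 / 2520) * X ^ 2 +
      C (-7409 / 105) * X + C (-503803 / 15120))
    (fun n => ?_) (by compute_degree) (by compute_degree)
    (by norm_num)
  rw [factorialMoment_four, Real.rpow_natCast]
  simp only [eval_add, eval_mul, eval_C, eval_pow, eval_X]
  ring

theorem factorialMoment_five_isBigO :
    (fun n : ℕ => factorialMoment 5 n - 565 / 2048 * (√(2 * Real.pi) / 4) *
      (n : ℝ) ^ (15 / 2 : ℝ)) =O[atTop] fun n : ℕ => (n : ℝ) ^ (7 : ℝ) := by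
  refine isBigO_of_polynomial_right (d := 6)
    (p := C (-105845 / 110592) * X ^ 7 + C (-2170159 / 290304) * X ^ 6 +
      C (-99955651 / 3870720) * X ^ 5 + C (-30773609 / 725760) * X ^ 4 +
      C (-94846903 / 11612160) * X ^ 3 + C (24676991 / 483840) * X ^ 2 +
      C (392763901 / 11612160) * X)
    (q := C (1005 / 128) * X ^ 5 + C (9832585 / 165888) * X ^ 4 + C (1111349 / 5184) * X ^ 3 +
      C (826358527 / 1935360) * X ^ 2 + C (159943787 / 362880) * X + C (1024580441 / 5806080))
    (fun n => ?_) (by compute_degree)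
    (Or.inl (Nat.succ_le_succ (n := _) (m := 5) (by compute_degree))) (by norm_num) (by norm_num)
  rw [factorialMoment_five]
  simp only [eval_add, eval_mul, eval_C, eval_pow, eval_X]
  ring

theorem factorialMoment_six_isBigO :
    (fun n : ℕ => factorialMoment 6 n - 82825 / 576576 * (n : ℝ) ^ ((9 : ℕ) : ℝ)) =O[atTop]
      fun n : ℕ => (n : ℝ) ^ (17 / 2 : ℝ) := by
  refine isBigO_of_polynomial_left (d := 7)
    (p := C (373340075 / 110702592) * X ^ 8 + C (9401544029 / 332107776) * X ^ 7 +
      C (14473244813 / 127733760) * X ^ 6 + C (414139396709 / 1660538880) * X ^ 5 +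
      C (88215445651 / 332107776) * X ^ 4 + C (-18783816473 / 332107776) * X ^ 3 +
      C (-643359542029 / 1660538880) * X ^ 2 + C (-358936540409 / 1660538880) * X)
    (q := C (-3955 / 2048) * X ^ 7 + C (-186349 / 6144) * X ^ 6 +
      C (-259283273 / 1161216) * X ^ 5 + C (-119912501 / 129024) * X ^ 4 +
      C (-149860633081 / 63866880) * X ^ 3 + C (-601794266581 / 166053888) * X ^ 2 +
      C (-864000570107 / 276756480) * X + C (-921390308389 / 830269440))
    (fun n => ?_) (by compute_degree) (by compute_degree)
    (by norm_num)
  rw [factorialMoment_six, Real.rpow_natCast]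
  simp only [eval_add, eval_mul, eval_C, eval_pow, eval_X]
  ring

end Asymptotics

/-! ### Values of the Airy moments -/

section Airy

theorem airyK_one : airyK 1 = 1 / 8 := by
  rw [airyK, airyK]; norm_num

theorem airyK_two : airyK 2 = 5 / 64 := by
  rw [airyK]; simp [airyK_one]; norm_num

theorem airyK_three : airyK 3 = 15 / 128 := by
  rw [airyK]; simp [airyK_one, airyK_two, Fin.sum_univ_succ]; norm_num

theorem airyK_four : airyK 4 = 1105 / 4096 := by
  rw [airyK]; simp [airyK_one, airyK_two, airyK_three, Fin.sum_univ_succ]; norm_num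

theorem airyK_five : airyK 5 = 1695 / 2048 := by
  rw [airyK]; simp [airyK_one, airyK_two, airyK_three, airyK_four, Fin.sum_univ_succ]; norm_num

theorem airyK_six : airyK 6 = 414125 / 131072 := by
  rw [airyK]
  simp [airyK_one, airyK_two, airyK_three, airyK_four, airyK_five, Fin.sum_univ_succ]
  norm_num

/-- For odd index the Gamma function is taken at the integer `3 * m + 1`, so `√π` survives; the
half-integral power of 2 supplies the `√2`. -/
theorem airyMoment_odd (m : ℕ) : airyMoment (2 * m + 1) =
    4 * √(2 * Real.pi) / 2 ^ (m + 1) * ((2 * m + 1).factorial : ℝ) / ((3 * m).factorial : ℝ)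
      * airyK (2 * m + 1) := by
  have h1 : Real.Gamma ((3 * ((2 * m + 1 : ℕ) : ℝ) - 1) / 2) = ((3 * m).factorial : ℝ) := by
    rw [← Real.Gamma_nat_eq_factorial]
    congr 1
    push_cast
    ring
  have h2 : (2 : ℝ) ^ (-((2 * m + 1 : ℕ) : ℝ) / 2) = √2 / 2 ^ (m + 1) := by
    rw [show -((2 * m + 1 : ℕ) : ℝ) / 2 = 1 / 2 - ((m + 1 : ℕ) : ℝ) by push_cast; ring,
      Real.rpow_sub two_pos, Real.rpow_natCast, Real.sqrt_eq_rpow]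
  rw [airyMoment, h1, h2, Real.sqrt_mul two_pos.le]
  ring

/-- For even index the Gamma function is taken at the half-integer `3 * m + 2 + 1/2`; its factor
`√π` cancels. -/
theorem airyMoment_even (m : ℕ) : airyMoment (2 * m + 2) =
    4 * 2 ^ (2 * m + 1) * ((2 * m + 2).factorial : ℝ) / (Nat.doubleFactorial (6 * m + 3) : ℝ)
      * airyK (2 * m + 2) := by
  have h1 : Real.Gamma ((3 * ((2 * m + 2 : ℕ) : ℝ) - 1) / 2) =
      (Nat.doubleFactorial (6 * m + 3) : ℝ) * √Real.pi / 2 ^ (3 * m + 2) := by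
    have h := Real.Gamma_nat_add_half (3 * m + 2)
    rw [show 2 * (3 * m + 2) - 1 = 6 * m + 3 by omega] at h
    rw [← h]
    congr 1
    push_cast
    ring
  have h2 : (2 : ℝ) ^ (-((2 * m + 2 : ℕ) : ℝ) / 2) = 1 / 2 ^ (m + 1) := by
    rw [show -((2 * m + 2 : ℕ) : ℝ) / 2 = -((m + 1 : ℕ) : ℝ) by push_cast; ring,
      Real.rpow_neg two_pos.le, Real.rpow_natCast, one_div]
  have h3 : (2 : ℝ) ^ (3 * m + 2) = 2 ^ (2 * m + 1) * 2 ^ (m + 1) := by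
    rw [← pow_add]; congr 1; ring
  have h4 : (Nat.doubleFactorial (6 * m + 3) : ℝ) ≠ 0 := by positivity
  have h5 : √Real.pi ≠ 0 := by positivity
  rw [airyMoment, h1, h2, h3]
  field_simp

theorem airyMoment_one : airyMoment 1 = √(2 * Real.pi) / 4 := by
  have h := airyMoment_odd 0
  norm_num [airyK_one, Nat.factorial] at h
  rw [h, Real.sqrt_mul two_pos.le]
  ring

theorem airyMoment_two : airyMoment 2 = 5 / 12 := by
  have h := airyMoment_even 0
  norm_num [airyK_two, Nat.factorial, Nat.doubleFactorial] at h
  exact h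

theorem airyMoment_three : airyMoment 3 = 15 / 32 * (√(2 * Real.pi) / 4) := by
  have h := airyMoment_odd 1
  norm_num [airyK_three, Nat.factorial] at h
  rw [h, Real.sqrt_mul two_pos.le]
  ring

theorem airyMoment_four : airyMoment 4 = 221 / 1008 := by
  have h := airyMoment_even 1
  norm_num [airyK_four, Nat.factorial, Nat.doubleFactorial] at h
  exact h

theorem airyMoment_five : airyMoment 5 = 565 / 2048 * (√(2 * Real.pi) / 4) := by
  have h := airyMoment_odd 2
  norm_num [airyK_five, Nat.factorial] at h
  rw [h, Real.sqrt_mul two_pos.le]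
  ring

theorem airyMoment_six : airyMoment 6 = 82825 / 576576 := by
  have h := airyMoment_even 2
  norm_num [airyK_six, Nat.factorial, Nat.doubleFactorial] at h
  exact h

end Airy

/-- The leading terms of the factorial moments are the moments of the Airy distribution. -/
theorem factorialMoment_sub_airyMoment_isBigO (k : ℕ) (h1 : 1 ≤ k) (h6 : k ≤ 6) :
    (fun n : ℕ => factorialMoment k n - airyMoment k * (n : ℝ) ^ (3 * (k : ℝ) / 2)) =O[atTop]
      fun n : ℕ => (n : ℝ) ^ ((3 * (k : ℝ) - 1) / 2) := by
  interval_cases k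
  · convert factorialMoment_one_isBigO using 5
    · exact airyMoment_one
    all_goals norm_num
  · convert factorialMoment_two_isBigO using 5
    · exact airyMoment_two
    all_goals norm_num
  · convert factorialMoment_three_isBigO using 5
    · exact airyMoment_three
    all_goals norm_num
  · convert factorialMoment_four_isBigO using 5
    · exact airyMoment_four
    all_goals norm_num
  · convert factorialMoment_five_isBigO using 5
    · exact airyMoment_five
    all_goals norm_num
  · convert factorialMoment_six_isBigO using 5
    · exact airyMoment_six
    all_goals norm_num

end Parking

theorem mainTheorem6 :
    -- closed form of the expectation
    (∀ n : ℕ, Parking.E₁ n =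
      -(n : ℝ) / 2 + 1 / 2 * (((n + 1).factorial : ℝ) / ((n : ℝ) + 1) ^ n)
        * ∑ k ∈ Finset.range n, ((n : ℝ) + 1) ^ k / (k.factorial : ℝ)) ∧
    -- second factorial moment
    (∀ n : ℕ, Parking.factorialMoment 2 n =
      (5 / 12 * (n : ℝ) ^ 3 - 1 / 12 * (n : ℝ) ^ 2 - 1 / 3 * (n : ℝ))
      + (-(7 / 3) * ((n : ℝ) + 1)) * Parking.E₁ n) ∧
    ((fun n : ℕ => Parking.factorialMoment 2 n - 5 / 12 * (n : ℝ) ^ 3)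
      =O[atTop] fun n : ℕ => (n : ℝ) ^ (5 / 2 : ℝ)) ∧
    -- third factorial moment
    (∀ n : ℕ, Parking.factorialMoment 3 n =
      (-(175 / 192) * (n : ℝ) ^ 4 - 283 / 192 * (n : ℝ) ^ 3 + 199 / 192 * (n : ℝ) ^ 2
       + 259 / 192 * (n : ℝ))
      + (15 / 32 * (n : ℝ) ^ 3 + 521 / 96 * (n : ℝ) ^ 2 + 1219 / 96 * (n : ℝ) + 743 / 96) * Parking.E₁ n) ∧
    ((fun n : ℕ => Parking.factorialMoment 3 n - 15 / 128 * √(2 * Real.pi) * (n : ℝ) ^ (9 / 2 : ℝ))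
      =O[atTop] fun n : ℕ => (n : ℝ) ^ 4) ∧
    -- fourth factorial moment
    (∀ n : ℕ, Parking.factorialMoment 4 n =
      (221 / 1008 * (n : ℝ) ^ 6 + 63737 / 30240 * (n : ℝ) ^ 5 + 101897 / 15120 * (n : ℝ) ^ 4
       + 22217 / 5040 * (n : ℝ) ^ 3 - 1375 / 189 * (n : ℝ) ^ 2 - 187463 / 30240 * (n : ℝ))
      + (-(35 / 16) * (n : ℝ) ^ 4 - 449 / 27 * (n : ℝ) ^ 3 - 130243 / 2520 * (n : ℝ) ^ 2
         - 7409 / 105 * (n : ℝ) - 503803 / 15120) * Parking.E₁ n) ∧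
    ((fun n : ℕ => Parking.factorialMoment 4 n - 221 / 1008 * (n : ℝ) ^ 6)
      =O[atTop] fun n : ℕ => (n : ℝ) ^ (11 / 2 : ℝ)) ∧
    -- fifth factorial moment
    (∀ n : ℕ, Parking.factorialMoment 5 n =
      (-(105845 / 110592) * (n : ℝ) ^ 7 - 2170159 / 290304 * (n : ℝ) ^ 6
       - 99955651 / 3870720 * (n : ℝ) ^ 5 - 30773609 / 725760 * (n : ℝ) ^ 4
       - 94846903 / 11612160 * (n : ℝ) ^ 3 + 24676991 / 483840 * (n : ℝ) ^ 2
       + 392763901 / 11612160 * (n : ℝ))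
      + (565 / 2048 * (n : ℝ) ^ 6 + 1005 / 128 * (n : ℝ) ^ 5
         + 9832585 / 165888 * (n : ℝ) ^ 4 + 1111349 / 5184 * (n : ℝ) ^ 3
         + 826358527 / 1935360 * (n : ℝ) ^ 2 + 159943787 / 362880 * (n : ℝ)
         + 1024580441 / 5806080) * Parking.E₁ n) ∧
    ((fun n : ℕ => Parking.factorialMoment 5 n - 565 / 8192 * √(2 * Real.pi) * (n : ℝ) ^ (15 / 2 : ℝ))
      =O[atTop] fun n : ℕ => (n : ℝ) ^ 7) ∧
    -- sixth factorial moment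
    (∀ n : ℕ, Parking.factorialMoment 6 n =
      (82825 / 576576 * (n : ℝ) ^ 9 + 373340075 / 110702592 * (n : ℝ) ^ 8
       + 9401544029 / 332107776 * (n : ℝ) ^ 7 + 14473244813 / 127733760 * (n : ℝ) ^ 6
       + 414139396709 / 1660538880 * (n : ℝ) ^ 5 + 88215445651 / 332107776 * (n : ℝ) ^ 4
       - 18783816473 / 332107776 * (n : ℝ) ^ 3 - 643359542029 / 1660538880 * (n : ℝ) ^ 2
       - 358936540409 / 1660538880 * (n : ℝ))
      + (-(3955 / 2048) * (n : ℝ) ^ 7 - 186349 / 6144 * (n : ℝ) ^ 6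
         - 259283273 / 1161216 * (n : ℝ) ^ 5 - 119912501 / 129024 * (n : ℝ) ^ 4
         - 149860633081 / 63866880 * (n : ℝ) ^ 3 - 601794266581 / 166053888 * (n : ℝ) ^ 2
         - 864000570107 / 276756480 * (n : ℝ) - 921390308389 / 830269440) * Parking.E₁ n) ∧
    ((fun n : ℕ => Parking.factorialMoment 6 n - 82825 / 576576 * (n : ℝ) ^ 9)
      =O[atTop] fun n : ℕ => (n : ℝ) ^ (17 / 2 : ℝ)) ∧
    -- the leading terms are given by the moments of the Airy distribution
    (∀ k : ℕ, 1 ≤ k → k ≤ 6 →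
      (fun n : ℕ => Parking.factorialMoment k n
          - Parking.airyMoment k * (n : ℝ) ^ (3 * (k : ℝ) / 2))
        =O[atTop] fun n : ℕ => (n : ℝ) ^ ((3 * (k : ℝ) - 1) / 2)) := by
  refine ⟨Parking.E₁_formula, Parking.factorialMoment_two, ?_, Parking.factorialMoment_three, ?_,
    Parking.factorialMoment_four, ?_, Parking.factorialMoment_five, ?_,
    Parking.factorialMoment_six, ?_, Parking.factorialMoment_sub_airyMoment_isBigO⟩
  · refine Parking.factorialMoment_two_isBigO.congr (fun n => ?_) fun n => by norm_num
    rw [Real.rpow_natCast]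
  · refine Parking.factorialMoment_three_isBigO.congr (fun n => by ring) fun n => ?_
    rw [← Real.rpow_natCast]; norm_num
  · refine Parking.factorialMoment_four_isBigO.congr (fun n => ?_) fun n => by norm_num
    rw [Real.rpow_natCast]
  · refine Parking.factorialMoment_five_isBigO.congr (fun n => by ring) fun n => ?_
    rw [← Real.rpow_natCast]; norm_num
  · refine Parking.factorialMoment_six_isBigO.congr (fun n => ?_) fun n => by norm_num
    rw [Real.rpow_natCast]
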